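/- Let $A=\mathbb F_2[x,y]/(y^2+y=x^3+x+1)$, $K=\operatorname{Frac}(A)$, let $\infty$ be the unique place at infinity and let $\deg a$ be the order of the pole of $a\in A$ at $\infty$ (so $\deg x=2$, $\deg y=3$). Every nonzero $a\in A$ is monic. For $d\ge 0$ put $$S_d(k)=\sum_{0\ne a\in A,\ \deg a=d}\frac1{a^k},\quad S_{<d}(k)=\sum_{i<d}S_i(k),\quad S_d(k_1,k_2)=S_d(k_1)S_{<d}(k_2),\quad S_{\le d}(k_1,k_2)=\sum_{i\le d}S_i(k_1,k_2).$$ Let $\rho$ be a Hayes module for $A$, i.e. a sign-normalized Drinfeld $A$-module of rank one, over a field $L\supseteq K$, and let $\log_\rho(z)=\sum_{i\ge0}z^{2^i}/\ell_i$ be its logarithm, that is, the series with linear term $z$ and $\log_\rho(\rho_a(z))=a\log_\rho(z)$ for all $a\in A$. Let $\mathbb F_2(x,y,X,Y)$ be the field of rational functions on the product of the curve with itself, where $x,X$ are independent transcendentals, $y^2+y=x^3+x+1$ and $Y^2+Y=X^3+X+1$. For a function $f$ in this field let $f^{(1)}$ be the result of substituting $X^2,Y^2$ for $X,Y$, and let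 $f(d)\in K$ be the result of substituting $x^{2^d},y^{2^d}$ for $X,Y$ (when $f$ is regular there). Put $$B_x=X+x,\quad B_y=Y+y,\quad g=\frac{B_y+XB_x}{B_x^{(1)}+1},\quad F_1=\frac{X+x^2}{B_y+xB_x+x^2+x},$$ $$F_{<1}=g^2+F_1^2+F_1,\quad F_{12}=F_1F_{<1}^2,\quad F_3=F_1^2(g^2+F_1^2),$$ $$g_m=\frac{Y^2+y^4+X^2(X^2+x^4)}{X^4+x^4+1},\quad A_2=F_1\Big(\frac{g^4g_m}{x^2+x}+(g^2+F_1^2+F_1)^2(F_1^2+F_1)\Big),$$ $$F_{<3}=\frac{A_2}{F_1}+(g^2+F_1^2+F_1)^3,$$ $$C=B_y+xB_x+x^2+x,\quad C_m=Y+y^2+x^2(X+x^2)+x^4+x^2,$$ $$U=\frac{(X+x^2)(X^3+X^2x)}{x^2+x}+\frac{X^2}{x}+Xx+1,\quad J=\frac{U+C^2}{1+\dfrac{(g^{(1)})^3C^2F_{12}}{C_mF_{12}^{(1)}}},\quad F_{\le12}=\frac{JF_{12}}{C_m}.$$ Then for every $d\ge2$ the coefficient $1/\ell_d$ of $\log_\rho$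 is nonzero (so that $\ell_d$ is defined), the six functions $F_1,F_{<1},F_{12},F_3,F_{<3},F_{\le12}$ are regular at $(X,Y)=(x^{2^d},y^{2^d})$, and $$\text{(i) } \ell_dS_d(1)=F_1(d),\qquad \text{(ii) } \ell_dS_{<d}(1)=F_{<1}(d),\qquad \text{(iii) } \ell_d^3S_d(1,2)=F_{12}(d),$$ $$\text{(iv) } \ell_d^3S_d(3)=F_3(d),\qquad \text{(v) } \ell_d^3S_{<d}(3)=F_{<3}(d),\qquad \text{(vi) } \ell_d^3S_{\le d}(1,2)=F_{\le12}(d).$$ -/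

import Mathlib

open Polynomial

noncomputable section

namespace MZV

/-! ### The curve, its coordinate ring and its function field -/

/-- The affine curve `y² + y = x³ + x + 1` over a field `F` (of characteristic two), as the
Weierstrass curve with `a₁ = 0, a₂ = 0, a₃ = 1, a₄ = 1, a₆ = 1`. -/
def curve (F : Type*) [Field F] : WeierstrassCurve.Affine F :=
  { a₁ := 0, a₂ := 0, a₃ := 1, a₄ := 1, a₆ := 1 }

/-- `A = 𝔽₂[x, y] / (y² + y = x³ + x + 1)`. -/
abbrev A : Type := (curve (ZMod 2)).CoordinateRing

/-- The fraction field `K` of `A`. -/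
abbrev K : Type := (curve (ZMod 2)).FunctionField

/-- The coordinate function `x ∈ A`. -/
def xA : A := WeierstrassCurve.Affine.CoordinateRing.mk (curve (ZMod 2)) (C X)

/-- The coordinate function `y ∈ A`. -/
def yA : A := WeierstrassCurve.Affine.CoordinateRing.mk (curve (ZMod 2)) X

/-- `x` as an element of `K`. -/
def xK : K := algebraMap A K xA

/-- `y` as an element of `K`. -/
def yK : K := algebraMap A K yA

/-- The degree of `a ∈ A`, i.e. the order of its pole at the unique place `∞` at infinity. The place
`∞` is the only place of `K` above the infinite place of `𝔽₂(x)`, and it has residue degree one, so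
this order is the degree in `x` of the norm of `a` from `A` to `𝔽₂[x]`; thus
`deg (p(x) + q(x) y) = max (2 deg p) (2 deg q + 3)`, `deg x = 2` and `deg y = 3`. -/
def deg (a : A) : ℕ := (Algebra.norm (ZMod 2)[X] a).natDegree

/-- The set of monic elements of degree `d` of `A`. Signs lie in `𝔽₂ˣ = {1}`, so every nonzero
element is monic. -/
def monicOfDegree (d : ℕ) : Set A := {a | a ≠ 0 ∧ deg a = d}

/-! ### Power sums -/

/-- The power sum `S_d(k) = ∑ 1 / a ^ k`, over the (finitely many) monic `a ∈ A` of degree `d`. -/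
def powerSum (d k : ℕ) : K := ∑ᶠ a ∈ monicOfDegree d, 1 / (algebraMap A K a) ^ k

/-- `S_{<d}(k₁, …, k_r) = ∑_{d > d₁ > ⋯ > d_r ≥ 0} S_{d₁}(k₁) ⋯ S_{d_r}(k_r)`, the empty tuple
giving `1`. -/
def sumLT : List ℕ → ℕ → K
  | [], _ => 1
  | k :: ks, d => ∑ i ∈ Finset.range d, powerSum i k * sumLT ks i

/-- `S_d(k₁, k₂, …, k_r) = S_d(k₁) S_{<d}(k₂, …, k_r)`. -/
def sumAt (k : ℕ) (ks : List ℕ) (d : ℕ) : K := powerSum d k * sumLT ks d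

/-- `S_{≤d}(k₁, …, k_r) = ∑_{i ≤ d} S_i(k₁, …, k_r)`. -/
def sumLE (k : ℕ) (ks : List ℕ) (d : ℕ) : K := ∑ i ∈ Finset.range (d + 1), sumAt k ks i

/-! ### Hayes modules and their logarithms -/

/-- The product in the twisted power series ring `L{{τ}}`, `τ c = c² τ`, whose elements
`∑ fₙ τⁿ` are given by their coefficients. Since `∑ fₙ τⁿ` acts as `∑ fₙ z^(2ⁿ)`, this is
composition of `𝔽₂`-linear power series. -/
def twistedMul {L : Type*} [Field L] (f g : ℕ → L) (n : ℕ) : L :=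
  ∑ p ∈ Finset.HasAntidiagonal.antidiagonal n, f p.1 * g p.2 ^ 2 ^ p.1

/-- A Hayes module over a field `L` containing `K`: a sign-normalized Drinfeld `A`-module of rank
one, i.e. a ring homomorphism `a ↦ ρ_a = ∑ coeff a n τⁿ` from `A` to `L{τ}`, such that `ρ_a` has
constant term `a`, and for `a ≠ 0` has `τ`-degree `deg a` and leading coefficient the sign of `a`,
which is `1`. -/
structure HayesModule (L : Type*) [Field L] [Algebra K L] where
  coeff : A → ℕ → L
  coeff_one : coeff 1 = fun n => if n = 0 then 1 else 0
  coeff_add : ∀ a b n, coeff (a + b) n = coeff a n + coeff b n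
  coeff_mul : ∀ a b n, coeff (a * b) n = twistedMul (coeff a) (coeff b) n
  coeff_at_zero : ∀ a, coeff a 0 = algebraMap K L (algebraMap A K a)
  coeff_deg : ∀ a, a ≠ 0 → coeff a (deg a) = 1
  coeff_of_deg_lt : ∀ a n, deg a < n → coeff a n = 0

variable {L : Type*} [Field L]

theorem twistedMul_assoc [CharP L 2] (f g h : ℕ → L) (n : ℕ) :
    twistedMul (twistedMul f g) h n = twistedMul f (twistedMul g h) n := by
  simp only [twistedMul, Finset.sum_mul, sum_pow_char_pow, Finset.mul_sum]
  rw [Finset.sum_sigma', Finset.sum_sigma']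
  refine Finset.sum_nbij' (fun p => ⟨(p.2.1, p.2.2 + p.1.2), (p.2.2, p.1.2)⟩)
    (fun p => ⟨(p.1.1 + p.2.1, p.2.2), (p.1.1, p.2.1)⟩) ?_ ?_ ?_ ?_ ?_
  · rintro ⟨⟨a, b⟩, c, e⟩ h
    simp only [Finset.mem_sigma, Finset.HasAntidiagonal.mem_antidiagonal, and_true] at h ⊢
    omega
  · rintro ⟨⟨a, b⟩, c, e⟩ h
    simp only [Finset.mem_sigma, Finset.HasAntidiagonal.mem_antidiagonal, and_true] at h ⊢
    omega
  · rintro ⟨⟨a, b⟩, c, e⟩ h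
    simp only [Finset.mem_sigma, Finset.HasAntidiagonal.mem_antidiagonal] at h
    obtain ⟨h1, h2⟩ := h
    simp [h2]
  · rintro ⟨⟨a, b⟩, c, e⟩ h
    simp only [Finset.mem_sigma, Finset.HasAntidiagonal.mem_antidiagonal] at h
    obtain ⟨h1, h2⟩ := h
    simp [h2]
  · rintro ⟨⟨a, b⟩, c, e⟩ h
    simp only [Finset.mem_sigma, Finset.HasAntidiagonal.mem_antidiagonal] at h
    obtain ⟨h1, h2⟩ := h
    simp only
    rw [← h2, mul_pow, ← pow_mul, ← pow_add, mul_assoc, add_comm e c]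

/-- The solution of `l₀ = 1`, `l * r = r₀ l`. -/
def logRec (r : ℕ → L) : ℕ → L
  | 0 => 1
  | n + 1 => (∑ i : Fin (n + 1), logRec r i * r (n + 1 - i) ^ 2 ^ (i : ℕ)) /
      (r 0 - r 0 ^ 2 ^ (n + 1))

theorem twistedMul_succ (f r : ℕ → L) (n : ℕ) :
    twistedMul f r (n + 1) =
      (∑ i : Fin (n + 1), f i * r (n + 1 - i) ^ 2 ^ (i : ℕ)) + f (n + 1) * r 0 ^ 2 ^ (n + 1) := by
  rw [twistedMul, Finset.Nat.sum_antidiagonal_eq_sum_range_succ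
    (fun i j => f i * r j ^ 2 ^ i), Finset.sum_range_succ, Finset.sum_range]
  simp

theorem twistedMul_logRec (r : ℕ → L) (hr : ∀ n, r 0 - r 0 ^ 2 ^ (n + 1) ≠ 0) (n : ℕ) :
    twistedMul (logRec r) r n = r 0 * logRec r n := by
  cases n with
  | zero => simp [twistedMul, logRec]
  | succ n =>
    have h : logRec r (n + 1) * (r 0 - r 0 ^ 2 ^ (n + 1)) =
        ∑ i : Fin (n + 1), logRec r i * r (n + 1 - i) ^ 2 ^ (i : ℕ) := by
      rw [logRec, div_mul_cancel₀ _ (hr n)]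
    rw [twistedMul_succ, ← h]
    ring

theorem eq_of_twistedMul (r : ℕ → L) (hr : ∀ n, r 0 - r 0 ^ 2 ^ (n + 1) ≠ 0) (f g : ℕ → L)
    (h0 : f 0 = g 0) (hf : ∀ n, twistedMul f r n = r 0 * f n)
    (hg : ∀ n, twistedMul g r n = r 0 * g n) : f = g := by
  funext n
  induction n using Nat.strong_induction_on with
  | _ n ih =>
    cases n with
    | zero => exact h0
    | succ n =>
      have h1 := hf (n + 1)
      have h2 := hg (n + 1)
      rw [twistedMul_succ] at h1 h2
      have h3 : (∑ i : Fin (n + 1), f i * r (n + 1 - i) ^ 2 ^ (i : ℕ)) =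
          ∑ i : Fin (n + 1), g i * r (n + 1 - i) ^ 2 ^ (i : ℕ) :=
        Finset.sum_congr rfl fun i _ => by rw [ih i i.2]
      rw [h3] at h1
      apply mul_right_cancel₀ (hr n)
      linear_combination h2 - h1

variable [Algebra K L]

/-- `∑ lₙ z^(2ⁿ)` is the logarithm of `ρ`: `l₀ = 1` and `log (ρ_a (z)) = a log z` for all `a`. -/
def HayesModule.IsLog (ρ : HayesModule L) (l : ℕ → L) : Prop :=
  l 0 = 1 ∧ ∀ a n, twistedMul l (ρ.coeff a) n = algebraMap K L (algebraMap A K a) * l n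

theorem xA_sub_ne_zero (n : ℕ) : xA - xA ^ 2 ^ (n + 1) ≠ 0 := by
  have h : xA - xA ^ 2 ^ (n + 1) = algebraMap (ZMod 2)[X] A (X - X ^ 2 ^ (n + 1)) := by
    rw [map_sub, map_pow]; rfl
  rw [h, Ne, FaithfulSMul.algebraMap_eq_zero_iff, sub_eq_zero]
  intro h'
  have h2 := congrArg natDegree h'
  rw [natDegree_X, natDegree_X_pow] at h2
  have := Nat.one_lt_two_pow (n := n + 1) (by omega)
  omega

theorem HayesModule.existsUnique_isLog (ρ : HayesModule L) : ∃! l : ℕ → L, ρ.IsLog l := by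
  have : CharP K 2 := charP_of_injective_algebraMap (algebraMap (ZMod 2) K).injective 2
  have : CharP L 2 := charP_of_injective_algebraMap (algebraMap K L).injective 2
  have hr : ∀ n, ρ.coeff xA 0 - ρ.coeff xA 0 ^ 2 ^ (n + 1) ≠ 0 := by
    intro n
    rw [ρ.coeff_at_zero, ← map_pow, ← map_pow, ← map_sub, ← map_sub, Ne, map_eq_zero,
      FaithfulSMul.algebraMap_eq_zero_iff]
    exact xA_sub_ne_zero n
  have hl := twistedMul_logRec _ hr
  refine ⟨logRec (ρ.coeff xA), ⟨by simp [logRec], fun a => ?_⟩, ?_⟩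
  · refine congrFun (eq_of_twistedMul _ hr _ (fun n => _ * _) ?_ ?_ ?_)
    · simp [twistedMul, logRec, ρ.coeff_at_zero]
    · intro n
      have h1 : twistedMul (ρ.coeff a) (ρ.coeff xA) = twistedMul (ρ.coeff xA) (ρ.coeff a) := by
        funext m
        rw [← ρ.coeff_mul, ← ρ.coeff_mul, mul_comm]
      rw [twistedMul_assoc, h1, ← twistedMul_assoc, funext hl]
      simp only [twistedMul, Finset.mul_sum, mul_assoc]
    · intro n
      have := hl n
      simp only [twistedMul, mul_assoc, ← Finset.mul_sum] at this ⊢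
      rw [this, mul_left_comm]
  · rintro l ⟨h0, h⟩
    refine eq_of_twistedMul _ hr _ _ (by simp [h0, logRec]) ?_ hl
    intro n
    rw [h, ρ.coeff_at_zero]

/-- The coefficients `lₙ` of the logarithm `log_ρ(z) = ∑ lₙ z^(2ⁿ)` of a Hayes module. -/
def HayesModule.logCoeff (ρ : HayesModule L) : ℕ → L := ρ.existsUnique_isLog.choose

/-- The reciprocal logarithm coefficients: `log_ρ(z) = ∑ z^(2ⁿ) / ℓₙ`. -/
def HayesModule.ell (ρ : HayesModule L) (n : ℕ) : L := (ρ.logCoeff n)⁻¹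

/-! ### Rational functions on the curve times itself and their specializations -/

/-- The field `𝔽₂(x, y, X, Y)` of rational functions on the product of the curve with itself: the
function field of the curve `Y² + Y = X³ + X + 1` over `K = 𝔽₂(x, y)`. -/
abbrev KK : Type := (curve K).FunctionField

/-- `x` in `𝔽₂(x, y, X, Y)`. -/
def xx : KK := algebraMap K KK xK

/-- `y` in `𝔽₂(x, y, X, Y)`. -/
def yy : KK := algebraMap K KK yK

/-- `X` in `𝔽₂(x, y, X, Y)`. -/
def XX : KK := algebraMap (curve K).CoordinateRing KK
  (WeierstrassCurve.Affine.CoordinateRing.mk (curve K) (C X))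

/-- `Y` in `𝔽₂(x, y, X, Y)`. -/
def YY : KK := algebraMap (curve K).CoordinateRing KK
  (WeierstrassCurve.Affine.CoordinateRing.mk (curve K) X)

theorem curve_eq : yK ^ 2 + yK = xK ^ 3 + xK + 1 := by
  have h : yA ^ 2 + yA = xA ^ 3 + xA + 1 := by
    have h0 := AdjoinRoot.mk_self (f := (curve (ZMod 2)).polynomial)
    rw [WeierstrassCurve.Affine.polynomial] at h0
    simp only [curve, map_add, map_pow, map_zero, map_one, zero_mul, one_mul,
      zero_add, add_zero] at h0
    exact sub_eq_zero.mp h0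
  have h' := congrArg (algebraMap A K) h
  simp only [map_add, map_pow, map_one] at h'
  exact h'

theorem evalEval_graph (d : ℕ) :
    (curve K).polynomial.evalEval (xK ^ 2 ^ d) (yK ^ 2 ^ d) = 0 := by
  have : CharP K 2 := charP_of_injective_algebraMap (algebraMap (ZMod 2) K).injective 2
  have h := congrArg (· ^ 2 ^ d) curve_eq
  simp only [add_pow_char_pow, one_pow] at h
  rw [WeierstrassCurve.Affine.evalEval_polynomial]
  simp only [curve]
  linear_combination h

/-- Restriction to the graph of the `d`-th power of Frobenius: the ring homomorphism
`K[X, Y] / (Y² + Y = X³ + X + 1) → K` that is the identity on `K` and sends `X` to `x^(2^d)`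
and `Y` to `y^(2^d)`. -/
def evalGraph (d : ℕ) : (curve K).CoordinateRing →+* K := AdjoinRoot.evalEval (evalEval_graph d)

/-- The rational function `f` is regular at the generic point of the graph of the `d`-th power of
Frobenius (i.e. it has a representation `p / q` whose denominator does not vanish there), and its
specialization `f(d) ∈ K`, seen in `L`, is `v`. -/
def SpecializesTo (d : ℕ) (f : KK) (v : L) : Prop :=
  ∃ p q : (curve K).CoordinateRing, evalGraph d q ≠ 0 ∧
    f = algebraMap _ KK p / algebraMap _ KK q ∧
    v = algebraMap K L (evalGraph d p / evalGraph d q)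

/-! ### The explicit functions

They are written as expressions in `x, y, X, Y`. The twist `f⁽¹⁾` of `f`, obtained by substituting
`X²` for `X` and `Y²` for `Y`, is `f x y (X ^ 2) (Y ^ 2)`. -/

section Functions

variable {F : Type*} [Field F] (x y X Y : F)

def Bx : F := X + x

def By : F := Y + y

def g : F := (By y Y + X * Bx x X) / (Bx x (X ^ 2) + 1)

def F1 : F := (X + x ^ 2) / (By y Y + x * Bx x X + x ^ 2 + x)

def FLT1 : F := g x y X Y ^ 2 + F1 x y X Y ^ 2 + F1 x y X Y

def F12 : F := F1 x y X Y * FLT1 x y X Y ^ 2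

def F3 : F := F1 x y X Y ^ 2 * (g x y X Y ^ 2 + F1 x y X Y ^ 2)

def gm : F := (Y ^ 2 + y ^ 4 + X ^ 2 * (X ^ 2 + x ^ 4)) / (X ^ 4 + x ^ 4 + 1)

def A2 : F := F1 x y X Y * (g x y X Y ^ 4 * gm x y X Y / (x ^ 2 + x) +
  (g x y X Y ^ 2 + F1 x y X Y ^ 2 + F1 x y X Y) ^ 2 * (F1 x y X Y ^ 2 + F1 x y X Y))

def FLT3 : F := A2 x y X Y / F1 x y X Y + (g x y X Y ^ 2 + F1 x y X Y ^ 2 + F1 x y X Y) ^ 3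

def CC : F := By y Y + x * Bx x X + x ^ 2 + x

def Cm : F := Y + y ^ 2 + x ^ 2 * (X + x ^ 2) + x ^ 4 + x ^ 2

def U : F := (X + x ^ 2) * (X ^ 3 + X ^ 2 * x) / (x ^ 2 + x) + X ^ 2 / x + X * x + 1

def J : F := (U x X + CC x y X Y ^ 2) /
  (1 + (g x y (X ^ 2) (Y ^ 2) ^ 3 * CC x y X Y ^ 2 * F12 x y X Y) /
    (Cm x y X Y * F12 x y (X ^ 2) (Y ^ 2)))

def FLE12 : F := J x y X Y * F12 x y X Y / Cm x y X Y

end Functions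

end MZV

end

/-! Write `l_d = 1/ℓ_d`. Everything reduces to the single function `g`, because `g(d) = l_{d-1}/l_d`
and `l_d = S_{≤d}(1)`.

Commutation of `ρ_x` with `ρ_y` and the curve equation force `ρ_x = x + (x² + x)τ + τ²`
(`linear_coeff_unique`). So `l` obeys a three-term recurrence; written for ratios, it is the
equation `g_twist` between `g` and its twist, whence `gVal_mul_logK`.

For `n ≥ 2` the coefficient of `τⁿ` in `ρ_a` is a polynomial in `a` with linear coefficient `l_n`
and quadratic coefficient `l_{n-1}²`. It vanishes for `deg a < n` and equals 1 for `deg a = n`, so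
it has the form `α e² + β e`, where `e` is the additive polynomial whose roots are the elements of
degree `< n`. Newton's identities express `S_n(1)` and `S_{<n}(1)` through the coefficients of `e`,
and comparison gives `S_{≤n}(1) (S_{≤n}(1) + l_n) = 0`. The first factor is 1 at `∞`, so `l_n =
S_{≤n}(1)` (`logK_eq_sumLT`).

Hence `S_{<d}(1) = g l_d` and `S_d(1) = (1 + g) l_d`. Since `e` has no cubic term, `S_d(3) = S_d(1)²
(S_d(1) + S_{<d}(1))`; moreover `S_{<d}(2) = S_{<d}(1)²`. With `F_1 = 1 + g` and `F_{<1} = g` this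
gives (i)–(iv). Part (v) is the closed form `sumLT_three_mul`, proved by induction. Part (vi)
follows from `S_{≤d}(1,2) = S_{≤d}(1)³ + S_{≤d}(3)` and the algebraic identity `sumLE12_identity`;
regularity there rests on `U + C² ≠ 0`. -/

noncomputable section

namespace MZV

open WeierstrassCurve.Affine

/-! ### Elimination: the relations that determine `ρ_x` -/

/-- The coefficients of `ρ_x` and `ρ_y` are parametrized by an Artin–Schreier root `m`. -/
theorem coeff_artinSchreier {F : Type*} [Field F] [CharP F 2] (x y v x1 y1 y2 m : F)
    (hv : v = y ^ 2 + y) (hv' : v = x ^ 3 + x + 1)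
    (h3 : x + x1 * y2 ^ 2 + y1 ^ 4 = y1 + y2 * x1 ^ 4 + x ^ 8)
    (h4 : x1 + y2 ^ 4 = y2 + x1 ^ 8)
    (r4 : y1 + y2 * y2 ^ 4 + y1 ^ 8 = x ^ 16 + x ^ 4 + x + x1 ^ 12 + x1 ^ 9 + x1 ^ 3)
    (r5 : y2 + y2 ^ 8 = x1 + x1 ^ 4 + x1 ^ 16) (hm : m = y2 + x1 ^ 2) :
  x1 = m ^ 2 + m ∧ y1 ^ 2 + y1 = m ^ 6 + m ^ 4 + m ^ 3 + x ^ 4 + x ^ 2 + x := by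
  -- `h4` reads `m⁴ = x1 + y2`, so `x1² + x1 = m⁴ + m`, while `r5` becomes `x1⁴ = m⁸ + m⁴`; squaring
  -- the former and comparing lowers the exponents.
  have a1 : x1 = m ^ 2 + m := by grind
  have a2 : y2 = m ^ 4 + m ^ 2 + m := by grind
  refine ⟨a1, ?_⟩
  have a3 : y1 ^ 4 + y1 = m ^ 12 + m ^ 8 + m ^ 4 + m ^ 3 + x + x ^ 8 := by
    subst a1 a2; clear r4 r5 h4 hm hv hv'; grind
  have a4 : y1 ^ 8 + y1 = m ^ 24 + m ^ 16 + m ^ 4 + m ^ 3 + m ^ 8 + x ^ 16 + x ^ 4 + x := by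
    subst a1 a2; clear a3 h3 r5 h4 hm hv hv'; grind
  -- The square of `a3` eliminates `y1⁴`; adding `a4` then leaves `y1² + y1`.
  have a5 : y1 ^ 8 + y1 ^ 2 = m ^ 24 + m ^ 16 + m ^ 8 + m ^ 6 + x ^ 2 + x ^ 16 := by
    have := congrArg (· ^ 2) a3
    clear r4 r5 h4 hm hv hv' h3 a3 a4; grind
  grind

/-- The relations between `ρ_x` and `ρ_y` in terms of `p = m + x` and `k`, with `p = k² + k`. -/
theorem artinSchreier_equations {F : Type*} [Field F] [CharP F 2] (x y v w x1 y1 y2 m p k : F)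
    (hv : v = y ^ 2 + y) (hv' : v = x ^ 3 + x + 1) (hw : w = x ^ 2 + x)
    (h1 : x * y1 + x1 * y ^ 2 = y * x1 + y1 * x ^ 2)
    (h2 : x * y2 + x1 * y1 ^ 2 + y ^ 4 = y + y1 * x1 ^ 2 + y2 * x ^ 4)
    (a1 : x1 = m ^ 2 + m) (a2 : y2 = m ^ 4 + m ^ 2 + m)
    (a3 : y1 ^ 2 + y1 = m ^ 6 + m ^ 4 + m ^ 3 + x ^ 4 + x ^ 2 + x)
    (hp : p = m + x) (hk : k = y1 + x ^ 2 + m ^ 2 + m ^ 3 + m + 1) :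
  k ^ 2 + k = p ∧ w * k = p * (w * p ^ 2 + p + 1 + w ^ 2) ∧
    (w + 1) * w ^ 3 * p = (w + 1) * w ^ 3 * p ^ 2 * (p + 1) ^ 2 +
      (w ^ 3 + w + 1) * p * (p + 1) * (w ^ 2 + p * (p + 1) * w + p ^ 2 * (p + 1) ^ 2) := by
  -- The expected solution is `m = x`, so `p` measures the deviation from it; `k` is `y1` shifted so
  -- that its Artin–Schreier equation has right side `p`.
  have b1 : k ^ 2 + k = p := by
    clear * - a3 hp hk; subst hp hk; grind
  have b2 : x1 = w + p ^ 2 + p := by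
    clear * - a1 hp hw; subst a1 hp hw; grind
  have b3 : y1 = k + v + p + p ^ 2 + x ^ 2 * p + x * p ^ 2 + p ^ 3 := by
    clear * - hp hk hv'; subst hp hk hv'; grind
  have b4 : w * y1 = v * x1 := by
    clear * - h1 hv hw; subst hv hw; grind
  have b5 : y2 = x * v + p ^ 4 + p ^ 2 + p := by
    clear * - a2 hp hv'; subst a2 hp hv'; grind
  have b6 : w * (k + p + p ^ 2 + x ^ 2 * p + x * p ^ 2 + p ^ 3) = v * (p ^ 2 + p) := by
    rw [b2, b3] at b4; clear * - b4; grind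
  refine ⟨b1, ?_, ?_⟩
  · clear * - b6 hv' hw; subst hv'; grind
  · have c1 : (w ^ 2 + w) * y2 = v ^ 2 + v + x1 * y1 * (y1 + x1) := by
      have : y ^ 4 + y = v ^ 2 + v := by
        clear * - hv; subst hv; grind
      clear * - h2 hw this; subst hw; grind
    -- The factor `w²` permits replacing `w * y1` by `v * x1`; afterwards `c3` and `c4` express what
    -- remains of `x` and `v` through `w`.
    have c2 : w ^ 2 * ((w ^ 2 + w) * y2 + v ^ 2 + v) = v * (v + w) * x1 ^ 3 := by
      rw [c1]
      clear * - b4; grind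
    have c3 : v * (v + w) = w ^ 3 + w + 1 := by
      clear * - hv' hw; subst hv' hw; grind
    have c4 : x * v * (w ^ 2 + w) + v ^ 2 + v = w * (w ^ 3 + w + 1) := by
      clear * - hv' hw; subst hv' hw; grind
    rw [c3] at c2
    have c5 : w ^ 2 * ((w ^ 2 + w) * (p ^ 4 + p ^ 2 + p) + w * (w ^ 3 + w + 1)) =
        (w ^ 3 + w + 1) * (w + p ^ 2 + p) ^ 3 := by
      rw [← b2, ← c2, b5, ← c4]; ring
    clear * - c5
    grind

/-- If `p ≠ 0`, then `w³ (w³ + w + 1)` is in the ideal of the two equations for `p`. -/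
theorem artinSchreier_param_eq_zero {F : Type*} [Field F] [CharP F 2] (w p k : F) (hw0 : w ≠ 0)
    (hw1 : w ^ 3 + w + 1 ≠ 0)
    (h1 : k ^ 2 + k = p) (h2 : w * k = p * (w * p ^ 2 + p + 1 + w ^ 2))
    (h3 : (w + 1) * w ^ 3 * p = (w + 1) * w ^ 3 * p ^ 2 * (p + 1) ^ 2 +
      (w ^ 3 + w + 1) * p * (p + 1) * (w ^ 2 + p * (p + 1) * w + p ^ 2 * (p + 1) ^ 2)) : p = 0 := by
  by_contra hp
  have e1 : w ^ 2 * p ^ 5 + p ^ 3 + w ^ 2 * p ^ 2 + (w ^ 4 + w + 1) * p + (w ^ 3 + w ^ 2 + w) =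
      0 := by
    apply mul_left_cancel₀ hp
    -- Multiplying `h1` by `w²` lets `h2` eliminate `k`.
    have : (w * k) ^ 2 + w * (w * k) = w ^ 2 * p := by rw [← h1]; ring
    rw [h2] at this
    clear * - this; grind
  have e2 : (w + 1) * w ^ 3 = (w + 1) * w ^ 3 * p * (p + 1) ^ 2 +
      (w ^ 3 + w + 1) * (p + 1) * (w ^ 2 + p * (p + 1) * w + p ^ 2 * (p + 1) ^ 2) := by
    apply mul_left_cancel₀ hp
    linear_combination h3
  have : w ^ 3 * (w ^ 3 + w + 1) = 0 := by
    clear * - e1 e2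
    linear_combination (norm := (clear e1 e2; grind))
      ((w ^ 2 + w ^ 3 + w ^ 4 + w ^ 7) + (w ^ 2 + w ^ 4 + w ^ 5 + w ^ 6 + w ^ 7) * p +
        (1 + w + w ^ 4 + w ^ 6) * p ^ 2 + (1 + w + w ^ 4 + w ^ 6) * p ^ 3) * e1 +
      ((w ^ 2 + w ^ 3 + w ^ 5) + (1 + w ^ 2 + w ^ 4 + w ^ 5 + w ^ 6) * p +
        (w ^ 2 + w ^ 5) * p ^ 3) * e2
  rcases mul_eq_zero.1 this with h | h
  · exact hw0 (pow_eq_zero_iff (by norm_num) |>.1 h)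
  · exact hw1 h

/-- The coefficients of a Hayes module are forced: `ρ_x = x + (x² + x) τ + τ²`. -/
theorem linear_coeff_unique {F : Type*} [Field F] [CharP F 2] (x y x1 y1 y2 : F)
    (hv : y ^ 2 + y = x ^ 3 + x + 1) (hw0 : x ^ 2 + x ≠ 0)
    (hw1 : (x ^ 2 + x) ^ 3 + (x ^ 2 + x) + 1 ≠ 0)
    (h1 : x * y1 + x1 * y ^ 2 = y * x1 + y1 * x ^ 2)
    (h2 : x * y2 + x1 * y1 ^ 2 + y ^ 4 = y + y1 * x1 ^ 2 + y2 * x ^ 4)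
    (h3 : x + x1 * y2 ^ 2 + y1 ^ 4 = y1 + y2 * x1 ^ 4 + x ^ 8)
    (h4 : x1 + y2 ^ 4 = y2 + x1 ^ 8)
    (r4 : y1 + y2 * y2 ^ 4 + y1 ^ 8 = x ^ 16 + x ^ 4 + x + x1 ^ 12 + x1 ^ 9 + x1 ^ 3)
    (r5 : y2 + y2 ^ 8 = x1 + x1 ^ 4 + x1 ^ 16) : x1 = x ^ 2 + x := by
  obtain ⟨a1, a3⟩ := coeff_artinSchreier x y (y ^ 2 + y) x1 y1 y2 _ rfl hv h3 h4 r4 r5 rfl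
  have a2 : y2 = (y2 + x1 ^ 2) ^ 4 + (y2 + x1 ^ 2) ^ 2 + (y2 + x1 ^ 2) := by
    clear * - h4 r5
    grind
  obtain ⟨b1, b2, b3⟩ := artinSchreier_equations x y _ _ x1 y1 y2 _ _ _ rfl hv rfl h1
     h2 a1 a2 a3 rfl rfl
  have hp := artinSchreier_param_eq_zero _ _ _ hw0 hw1 b1 b2 b3
  generalize y2 + x1 ^ 2 = m at *
  clear * - a1 hp
  subst a1
  grind

/-! ### Algebraic identities for `g` -/

section Identities

variable {F : Type*} [Field F] [CharP F 2] {x y X Y : F}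

/-- The numerator `N` of `g` satisfies `N² + N = (X² + x + 1)(X² + X + x² + x)`, by the two curve
equations. -/
theorem g_quadratic (h : y ^ 2 + y = x ^ 3 + x + 1) (H : Y ^ 2 + Y = X ^ 3 + X + 1)
    (hD : X ^ 2 + x + 1 ≠ 0) {g : F} (hg : g * (X ^ 2 + x + 1) = Y + y + X ^ 2 + x * X) :
    (X ^ 2 + x + 1) * g ^ 2 + g + X ^ 2 + X + (x ^ 2 + x) = 0 := by
  apply mul_left_cancel₀ hD
  clear hD
  grind

/-- With `g = l_{d-1}/l_d` and `g' = l_d/l_{d+1}` this is the three-term recurrence of the logarithm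
coefficients. -/
theorem g_twist (h : y ^ 2 + y = x ^ 3 + x + 1) (H : Y ^ 2 + Y = X ^ 3 + X + 1)
    (hD : X ^ 2 + x + 1 ≠ 0) (hD' : X ^ 4 + x + 1 ≠ 0) {g g' : F}
    (hg : g * (X ^ 2 + x + 1) = Y + y + X ^ 2 + x * X)
    (hg' : g' * (X ^ 4 + x + 1) = Y ^ 2 + y + X ^ 4 + x * X ^ 2) :
    g' * (X ^ 2 + X + g) = X ^ 2 + x := by
  apply mul_left_cancel₀ hD
  apply mul_left_cancel₀ hD'
  have e : (Y ^ 2 + y + X ^ 4 + x * X ^ 2) * ((X ^ 2 + X) * (X ^ 2 + x + 1) +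
      (Y + y + X ^ 2 + x * X)) = (X ^ 2 + x) * (X ^ 2 + x + 1) * (X ^ 4 + x + 1) := by
    clear hD hD' hg hg'
    grind
  rw [← hg, ← hg'] at e
  linear_combination e

/-- On graphs `gm` is the fourth power of the preceding value of `g`, so this is the fourth power of
`g_twist` one Frobenius step earlier. The numerator and denominator of `gm` are squares, so the
square root of the identity is proved first. -/
theorem gm_eq (h : y ^ 2 + y = x ^ 3 + x + 1) (H : Y ^ 2 + Y = X ^ 3 + X + 1)
    (hD : X ^ 2 + x + 1 ≠ 0) (hDm : X ^ 4 + x ^ 4 + 1 ≠ 0) {g gm : F}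
    (hg : g * (X ^ 2 + x + 1) = Y + y + X ^ 2 + x * X)
    (hgm : gm * (X ^ 4 + x ^ 4 + 1) = Y ^ 2 + y ^ 4 + X ^ 2 * (X ^ 2 + x ^ 4)) :
    g ^ 4 * gm = X ^ 4 + x ^ 4 + g ^ 4 * (X ^ 4 + X ^ 2) := by
  have e0 : (Y + y + X ^ 2 + x * X) ^ 2 *
      (Y + y ^ 2 + X ^ 2 + X * x ^ 2 + (X ^ 2 + x ^ 2 + 1) * (X ^ 2 + X)) =
      (X ^ 2 + x + 1) ^ 2 * ((X ^ 2 + x ^ 2 + 1) * (X ^ 2 + x ^ 2)) := by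
    clear hD hDm hg hgm
    grind
  have e1 : g ^ 2 * (Y + y ^ 2 + X ^ 2 + X * x ^ 2 + (X ^ 2 + x ^ 2 + 1) * (X ^ 2 + X)) =
      (X ^ 2 + x ^ 2 + 1) * (X ^ 2 + x ^ 2) := by
    apply mul_left_cancel₀ (pow_ne_zero 2 hD)
    rw [← hg] at e0
    linear_combination e0
  have e2 := congrArg (· ^ 2) e1
  apply mul_left_cancel₀ hDm
  clear * - e2 hgm
  have e3 : g ^ 4 *
      (Y ^ 2 + y ^ 4 + X ^ 4 + X ^ 2 * x ^ 4 + (X ^ 4 + x ^ 4 + 1) * (X ^ 4 + X ^ 2)) =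
      (X ^ 4 + x ^ 4 + 1) * (X ^ 4 + x ^ 4) := by
    clear hgm
    grind
  clear e2
  grind

/-- The reason is the factorization `C (C + 1) = (X + x²)(X² + x + 1)`, together with `1 + g = (C +
1)/(X² + x + 1)`. -/
theorem F1_eq (h : y ^ 2 + y = x ^ 3 + x + 1) (H : Y ^ 2 + Y = X ^ 3 + X + 1)
    (hD : X ^ 2 + x + 1 ≠ 0) (hC : CC x y X Y ≠ 0) : F1 x y X Y = 1 + g x y X Y := by
  simp only [F1, g, CC, By, Bx] at hC ⊢
  rw [div_eq_iff hC, eq_comm, show (1 : F) + (Y + y + X * (X + x)) / (X ^ 2 + x + 1) =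
    (X ^ 2 + x + 1 + (Y + y + X * (X + x))) / (X ^ 2 + x + 1) by field_simp, div_mul_eq_mul_div,
    div_eq_iff hD]
  clear hC hD
  grind

/-- The inductive step for `S_{<d}(3)` with the powers of `l_d` divided out; it is a consequence of
the quadratic equation of `g`. -/
theorem sumLT3_step {g w : F} (hw : w = x ^ 2 + x)
    (hg : (X ^ 2 + x + 1) * g ^ 2 + g + X ^ 2 + X + w = 0) :
    (g ^ 4 + w) * (X ^ 2 + x) =
      (X ^ 2 + X + g) * (X ^ 4 + x ^ 4 + g ^ 4 * (X ^ 4 + X ^ 2 + w) + w * (1 + g ^ 2)) := by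
  subst hw
  grind

/-- The cross-multiplied form of (vi), with `τ = g² + F_{<3}`. Multiplication by `w` clears `U` and
`τ`, multiplication by `X² + X + g` clears `g'`, and the rest lies in the ideal of the quadratic
equation of `g`. -/
theorem sumLE12_identity {w g g' U τ C Cm : F} (hw : w = x ^ 2 + x)
    (hg : (X ^ 2 + x + 1) * g ^ 2 + g + X ^ 2 + X + w = 0)
    (hg' : g' * (X ^ 2 + X + g) = X ^ 2 + x) (hn : X ^ 2 + X + g ≠ 0)
    (hU : U * w = (X + x ^ 2) * (X ^ 3 + X ^ 2 * x) + X ^ 2 * (x + 1) + X * x * w + w)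
    (hw0 : w ≠ 0) (hC : C = (X ^ 2 + x + 1) * g + X ^ 2 + x)
    (hCm : Cm = C + x * X + x ^ 3 + 1 + x ^ 2 * X + x ^ 2)
    (hτ : τ * w = (1 + g ^ 2) * g ^ 2 * w + X ^ 4 + x ^ 4 + g ^ 4 * (X ^ 4 + X ^ 2)) :
    (U + C ^ 2) * (1 + g) * g ^ 2 * (1 + g') =
      (Cm * (1 + g') + C ^ 2 * g' * (1 + g) * g ^ 2) * τ := by
  apply mul_left_cancel₀ hw0
  apply mul_left_cancel₀ hn
  have e1 : w * ((U + C ^ 2) * (1 + g) * g ^ 2 * ((X ^ 2 + X + g) + (X ^ 2 + x))) =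
      (Cm * ((X ^ 2 + X + g) + (X ^ 2 + x)) + C ^ 2 * (X ^ 2 + x) * (1 + g) * g ^ 2) *
        (τ * w) := by
    rw [hτ, show w * ((U + C ^ 2) * (1 + g) * g ^ 2 * ((X ^ 2 + X + g) + (X ^ 2 + x))) =
      (U * w + C ^ 2 * w) * (1 + g) * g ^ 2 * ((X ^ 2 + X + g) + (X ^ 2 + x)) by ring,
      hU, hCm, hC, hw]
    subst hw
    clear * - hg
    grind
  rw [← hg'] at e1
  linear_combination e1

end Identities

instance charP_K : CharP K 2 :=
  charP_of_injective_algebraMap (algebraMap (ZMod 2) K).injective 2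

instance charP_A : CharP A 2 :=
  charP_of_injective_algebraMap (algebraMap (ZMod 2) A).injective 2

/-! ### The degree on `A` -/

/-- The degree on `A`, with `⊥` as the degree of `0`. -/
def degN (a : A) : WithBot ℕ := (Algebra.norm (ZMod 2)[X] a).degree

theorem exists_coords (a : A) : ∃ p q : (ZMod 2)[X],
    a = p • (1 : A) + q • CoordinateRing.mk (curve (ZMod 2)) X := by
  obtain ⟨p, q, h⟩ := CoordinateRing.exists_smul_basis_eq a
  exact ⟨p, q, h.symm⟩

theorem degN_coords (p q : (ZMod 2)[X]) :
    degN (p • (1 : A) + q • CoordinateRing.mk (curve (ZMod 2)) X) =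
      max (2 • p.degree) (2 • q.degree + 3) :=
  CoordinateRing.degree_norm_smul_basis p q

theorem degN_mul (a b : A) : degN (a * b) = degN a + degN b := by
  simp [degN, degree_mul]

/-- Degree bounds become linear conditions on coefficients: the monomials `xⁱ` and `xⁱ y` have the
distinct degrees `2i` and `2i + 3`. -/
theorem degN_coords_lt_iff (p q : (ZMod 2)[X]) (n : ℕ) :
    degN (p • (1 : A) + q • CoordinateRing.mk (curve (ZMod 2)) X) < n ↔
      (∀ i, n ≤ 2 * i → p.coeff i = 0) ∧ ∀ i, n ≤ 2 * i + 3 → q.coeff i = 0 := by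
  rw [degN_coords, max_lt_iff]
  refine and_congr ?_ ?_
  · by_cases hp : p = 0
    · simp [hp]
    · rw [degree_eq_natDegree hp, two_nsmul]
      norm_cast
      refine ⟨fun h i hi => coeff_eq_zero_of_natDegree_lt (by omega), fun h => ?_⟩
      by_contra hn
      exact hp (leadingCoeff_eq_zero.1 (h _ (by omega)))
  · by_cases hp : q = 0
    · simp [hp]
    · rw [degree_eq_natDegree hp, two_nsmul]
      norm_cast
      refine ⟨fun h i hi => coeff_eq_zero_of_natDegree_lt (by omega), fun h => ?_⟩
      by_contra hn
      exact hp (leadingCoeff_eq_zero.1 (h _ (by omega)))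

theorem degN_eq_bot {a : A} : degN a = ⊥ ↔ a = 0 := by
  rw [degN, degree_eq_bot, Algebra.norm_eq_zero_iff_of_basis (CoordinateRing.basis _)]

theorem degN_zero : degN 0 = ⊥ := degN_eq_bot.2 rfl

theorem degN_one : degN 1 = 0 := by simp [degN]

theorem degN_eq_deg {a : A} (ha : a ≠ 0) : degN a = deg a :=
  degree_eq_natDegree fun h => ha (degN_eq_bot.1 (by rw [degN, h, degree_zero]))

theorem degN_add_lt {a b : A} {n : ℕ} (ha : degN a < n) (hb : degN b < n) : degN (a + b) < n := by
  obtain ⟨p, q, rfl⟩ := exists_coords a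
  obtain ⟨r, s, rfl⟩ := exists_coords b
  rw [degN_coords_lt_iff] at ha hb
  rw [add_add_add_comm, ← add_smul, ← add_smul, degN_coords_lt_iff]
  exact ⟨fun i hi => by rw [coeff_add, ha.1 i hi, hb.1 i hi, add_zero],
    fun i hi => by rw [coeff_add, ha.2 i hi, hb.2 i hi, add_zero]⟩

/-- Leading coefficients are nonzero elements of `𝔽₂`, hence both 1, and cancel. -/
theorem degN_add_lt_of_eq {a b : A} {n : ℕ} (ha : degN a = n) (hb : degN b = n) :
    degN (a + b) < n := by
  have key : ∀ c d : ZMod 2, c ≠ 0 → d ≠ 0 → c + d = 0 := by decide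
  have ha1 : degN a < (n + 1 : ℕ) := by rw [ha]; exact_mod_cast n.lt_succ_self
  have hb1 : degN b < (n + 1 : ℕ) := by rw [hb]; exact_mod_cast n.lt_succ_self
  have ha2 : ¬ degN a < n := by simp [ha]
  have hb2 : ¬ degN b < n := by simp [hb]
  obtain ⟨p, q, rfl⟩ := exists_coords a
  obtain ⟨r, s, rfl⟩ := exists_coords b
  rw [degN_coords_lt_iff] at ha1 ha2 hb1 hb2
  rw [add_add_add_comm, ← add_smul, ← add_smul, degN_coords_lt_iff]
  have top : ∀ {p q : (ZMod 2)[X]}, ((∀ i, n + 1 ≤ 2 * i → p.coeff i = 0) ∧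
      ∀ i, n + 1 ≤ 2 * i + 3 → q.coeff i = 0) →
      ¬ ((∀ i, n ≤ 2 * i → p.coeff i = 0) ∧ ∀ i, n ≤ 2 * i + 3 → q.coeff i = 0) →
      (∀ i, 2 * i = n → p.coeff i ≠ 0) ∧ ∀ i, 2 * i + 3 = n → q.coeff i ≠ 0 := by
    intro p q h1 h2
    constructor
    · intro i hi h0
      refine h2 ⟨fun j hj => ?_, fun j hj => h1.2 j (by omega)⟩
      rcases eq_or_ne j i with rfl | hji
      · exact h0
      · exact h1.1 j (by omega)
    · intro i hi h0
      refine h2 ⟨fun j hj => h1.1 j (by omega), fun j hj => ?_⟩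
      rcases eq_or_ne j i with rfl | hji
      · exact h0
      · exact h1.2 j (by omega)
  have ta := top ha1 ha2
  have tb := top hb1 hb2
  constructor
  · intro i hi
    rw [coeff_add]
    rcases hi.eq_or_lt with hi | hi
    · exact key _ _ (ta.1 i hi.symm) (tb.1 i hi.symm)
    · rw [ha1.1 i hi, hb1.1 i hi, add_zero]
  · intro i hi
    rw [coeff_add]
    rcases hi.eq_or_lt with hi | hi
    · exact key _ _ (ta.2 i hi.symm) (tb.2 i hi.symm)
    · rw [ha1.2 i hi, hb1.2 i hi, add_zero]

theorem degN_add_eq {a b : A} {n : ℕ} (ha : degN a < n) (hb : degN b = n) : degN (a + b) = n := by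
  have h1 : degN (a + b) < (n + 1 : ℕ) := by
    refine degN_add_lt (ha.trans ?_) (by rw [hb]; exact_mod_cast n.lt_succ_self)
    exact_mod_cast n.lt_succ_self
  have h2 : ¬ degN (a + b) < n := by
    intro h
    have := degN_add_lt ha h
    rw [← add_assoc, CharTwo.add_self_eq_zero, zero_add, hb] at this
    exact lt_irrefl _ this
  refine le_antisymm ?_ (not_lt.1 h2)
  by_contra h
  exact (Nat.WithBot.add_one_le_of_lt (not_le.1 h)).not_gt (by simpa using h1)

/-! ### The finite spaces of elements of bounded degree -/

/-- A monomial of degree `n + 2`. -/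
def mono (n : ℕ) : A :=
  -- Pole orders skip 1, hence the offset 2. The zero summands match the shape of `degN_coords`.
  if Even n then (X ^ (n / 2 + 1) : (ZMod 2)[X]) • (1 : A) + (0 : (ZMod 2)[X]) •
    CoordinateRing.mk (curve (ZMod 2)) X
  else (0 : (ZMod 2)[X]) • (1 : A) + (X ^ (n / 2) : (ZMod 2)[X]) •
    CoordinateRing.mk (curve (ZMod 2)) X

theorem degN_mono (n : ℕ) : degN (mono n) = (n + 2 : ℕ) := by
  unfold mono
  split_ifs with h
  · obtain ⟨k, rfl⟩ := h
    rw [degN_coords, degree_X_pow, degree_zero, show (k + k) / 2 = k by omega,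
      two_nsmul, two_nsmul, WithBot.bot_add, WithBot.bot_add, max_bot_right]
    norm_cast
    omega
  · obtain ⟨k, rfl⟩ := Nat.not_even_iff_odd.1 h
    rw [degN_coords, degree_X_pow, degree_zero, show (2 * k + 1) / 2 = k by omega,
      two_nsmul, two_nsmul, WithBot.bot_add, max_bot_left]
    norm_cast
    omega

open Classical in
/-- The elements of degree less than `n + 2`. -/
def lowDegree : ℕ → Finset A
  | 0 => {0, 1}
  | n + 1 => lowDegree n ∪ (lowDegree n).image (· + mono n)

theorem mem_lowDegree {n : ℕ} {a : A} : a ∈ lowDegree n ↔ degN a < (n + 2 : ℕ) := by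
  induction n generalizing a with
  | zero =>
    simp only [lowDegree, Finset.mem_insert, Finset.mem_singleton]
    constructor
    · rintro (rfl | rfl)
      · rw [degN_zero]; exact WithBot.bot_lt_coe _
      · rw [degN_one]; norm_num
    · intro h
      obtain ⟨p, q, rfl⟩ := exists_coords a
      rw [degN_coords_lt_iff] at h
      have hq : q = 0 := by
        ext i
        rw [h.2 i (by omega), coeff_zero]
      have hp : p = C (p.coeff 0) := by
        ext i
        rcases Nat.eq_zero_or_pos i with rfl | hi
        · simp
        · rw [h.1 i (by omega), coeff_C_of_ne_zero hi.ne']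
      have key : ∀ c : ZMod 2, c = 0 ∨ c = 1 := by decide
      rw [hq, hp, zero_smul, add_zero]
      rcases key (p.coeff 0) with h | h
      · left; simp [h]
      · right; simp [h]
  | succ n ih =>
    simp only [lowDegree, Finset.mem_union, Finset.mem_image, ih]
    constructor
    · rintro (h | ⟨b, hb, rfl⟩)
      · exact h.trans (by norm_cast; omega)
      · rw [degN_add_eq hb (degN_mono n)]
        norm_cast; omega
    · intro h
      by_cases h' : degN a < (n + 2 : ℕ)
      · exact Or.inl h'
      · refine Or.inr ⟨a + mono n, degN_add_lt_of_eq ?_ (degN_mono n), ?_⟩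
        · refine le_antisymm ?_ (not_lt.1 h')
          by_contra h2
          refine (Nat.WithBot.add_one_le_of_lt (not_le.1 h2)).not_gt ?_
          exact_mod_cast h
        · rw [add_assoc, CharTwo.add_self_eq_zero, add_zero]

theorem disjoint_lowDegree (n : ℕ) :
    Disjoint (lowDegree n) ((lowDegree n).image (· + mono n)) := by
  rw [Finset.disjoint_left]
  intro a ha h
  obtain ⟨b, hb, rfl⟩ := Finset.mem_image.1 h
  rw [mem_lowDegree] at ha hb
  rw [degN_add_eq hb (degN_mono n)] at ha
  exact lt_irrefl _ ha

theorem mem_monicOfDegree_iff {a : A} {d : ℕ} : a ∈ monicOfDegree d ↔ degN a = d := by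
  constructor
  · rintro ⟨ha, rfl⟩
    exact degN_eq_deg ha
  · intro h
    have ha : a ≠ 0 := by
      rintro rfl
      simp [degN_zero] at h
    exact ⟨ha, by rw [degN_eq_deg ha] at h; exact_mod_cast h⟩

open Classical in
theorem monicOfDegree_add_two (n : ℕ) :
    monicOfDegree (n + 2) = ((lowDegree n).image (· + mono n) : Finset A) := by
  ext a
  rw [mem_monicOfDegree_iff, Finset.mem_coe, Finset.mem_image]
  constructor
  · intro h
    exact ⟨a + mono n, mem_lowDegree.2 (degN_add_lt_of_eq h (degN_mono n)), by
      rw [add_assoc, CharTwo.add_self_eq_zero, add_zero]⟩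
  · rintro ⟨b, hb, rfl⟩
    exact degN_add_eq (mem_lowDegree.1 hb) (degN_mono n)

theorem powerSum_add_two (n k : ℕ) :
    powerSum (n + 2) k = ∑ a ∈ lowDegree n, 1 / algebraMap A K (a + mono n) ^ k := by
  classical
  rw [powerSum, monicOfDegree_add_two, finsum_mem_coe_finset,
    Finset.sum_image fun a _ b _ h => add_right_cancel h]

theorem powerSum_zero (k : ℕ) : powerSum 0 k = 1 := by
  have h : monicOfDegree 0 = {1} := by
    ext a
    rw [mem_monicOfDegree_iff, Set.mem_singleton_iff]
    constructor
    · intro h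
      have h1 : a ∈ lowDegree 0 := mem_lowDegree.2 (by rw [h]; norm_num)
      simp only [lowDegree, Finset.mem_insert, Finset.mem_singleton] at h1
      refine h1.resolve_left ?_
      rintro rfl
      simp [degN_zero] at h
    · rintro rfl
      exact degN_one
  rw [powerSum, h, finsum_mem_singleton, map_one, one_pow, div_one]

/-- Degree 1 is the gap of the pole orders at `∞`, the curve having genus one. -/
theorem powerSum_one (k : ℕ) : powerSum 1 k = 0 := by
  have h : monicOfDegree 1 = ∅ := by
    ext a
    rw [mem_monicOfDegree_iff, Set.mem_empty_iff_false, iff_false]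
    exact CoordinateRing.degree_norm_ne_one a
  rw [powerSum, h, finsum_mem_empty]

/-! ### Small elements at infinity -/

/-- The elements of `K` vanishing at `∞`. -/
def IsSmall (f : K) : Prop :=
  ∃ a b : A, b ≠ 0 ∧ degN a < degN b ∧ f = algebraMap A K a / algebraMap A K b

theorem algebraMap_ne_zero {a : A} (ha : a ≠ 0) : algebraMap A K a ≠ 0 := by
  simpa using ha

theorem degN_ne_bot {a : A} (ha : a ≠ 0) : degN a ≠ ⊥ := mt degN_eq_bot.1 ha

theorem IsSmall.zero : IsSmall 0 :=
  ⟨0, 1, one_ne_zero, by rw [degN_zero, degN_one]; exact WithBot.bot_lt_coe _, by simp⟩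

theorem IsSmall.add {f g : K} (hf : IsSmall f) (hg : IsSmall g) : IsSmall (f + g) := by
  obtain ⟨a, b, hb, hab, rfl⟩ := hf
  obtain ⟨c, e, he, hce, rfl⟩ := hg
  refine ⟨a * e + b * c, b * e, mul_ne_zero hb he, ?_, ?_⟩
  · rw [degN_eq_deg (mul_ne_zero hb he)]
    apply degN_add_lt
    · rw [← degN_eq_deg (mul_ne_zero hb he), degN_mul, degN_mul]
      exact WithBot.add_lt_add_right (degN_ne_bot he) hab
    · rw [← degN_eq_deg (mul_ne_zero hb he), degN_mul, degN_mul]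
      exact WithBot.add_lt_add_left (degN_ne_bot hb) hce
  · rw [div_add_div _ _ (algebraMap_ne_zero hb) (algebraMap_ne_zero he)]
    simp only [map_add, map_mul]

theorem IsSmall.sum {ι : Type*} (s : Finset ι) (f : ι → K) (h : ∀ i ∈ s, IsSmall (f i)) :
    IsSmall (∑ i ∈ s, f i) :=
  Finset.sum_induction _ _ (fun _ _ => IsSmall.add) IsSmall.zero h

theorem not_isSmall_one : ¬ IsSmall 1 := by
  rintro ⟨a, b, hb, hab, h⟩
  rw [eq_div_iff (algebraMap_ne_zero hb), one_mul] at h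
  rw [FaithfulSMul.algebraMap_injective A K h] at hab
  exact lt_irrefl _ hab

theorem isSmall_powerSum (n : ℕ) : IsSmall (powerSum (n + 2) 1) := by
  rw [powerSum_add_two]
  refine IsSmall.sum _ _ fun a ha => ⟨1, a + mono n, ?_, ?_, by simp⟩
  · intro h
    have := degN_add_eq (mem_lowDegree.1 ha) (degN_mono n)
    rw [h, degN_zero] at this
    exact WithBot.bot_ne_coe this
  · rw [degN_one, degN_add_eq (mem_lowDegree.1 ha) (degN_mono n)]
    norm_cast; omega

theorem sumLT_singleton_succ (k d : ℕ) : sumLT [k] (d + 1) = sumLT [k] d + powerSum d k := by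
  simp [sumLT, Finset.sum_range_succ]

theorem sumLT_singleton_two (k : ℕ) : sumLT [k] 2 = 1 := by
  simp [sumLT, Finset.sum_range_succ, powerSum_zero, powerSum_one]

/-- The term of degree 0 is 1 and all later ones vanish at `∞`, so the sum has value 1 there. -/
theorem sumLT_ne_zero (n : ℕ) : sumLT [1] (n + 2) ≠ 0 := by
  have h : ∀ n, IsSmall (1 + sumLT [1] (n + 2)) := by
    intro n
    induction n with
    | zero =>
      rw [sumLT_singleton_two, CharTwo.add_self_eq_zero]
      exact IsSmall.zero
    | succ n ih =>
      rw [show n + 1 + 2 = (n + 2) + 1 from rfl, sumLT_singleton_succ, ← add_assoc]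
      exact ih.add (isSmall_powerSum n)
  intro h0
  have := h n
  rw [h0, add_zero] at this
  exact not_isSmall_one this

/-! ### The additive polynomials with roots the elements of bounded degree -/

/-- The monic polynomial whose roots are the elements of degree less than `n + 2`. -/
def rootPoly : ℕ → K[X]
  | 0 => X ^ 2 + X
  | n + 1 => rootPoly n ^ 2 + C ((rootPoly n).eval (algebraMap A K (mono n))) * rootPoly n

/-- The value of `rootPoly n` at the elements of degree `n + 2`. -/
def rootVal (n : ℕ) : K := (rootPoly n).eval (algebraMap A K (mono n))

theorem rootPoly_succ (n : ℕ) :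
    rootPoly (n + 1) = rootPoly n ^ 2 + C (rootVal n) * rootPoly n := rfl

/-- Additivity: squaring is additive in characteristic two, so `e ↦ e² + c e` preserves it. -/
theorem rootPoly_comp (n : ℕ) (u : K) :
    (rootPoly n).comp (X + C u) = rootPoly n + C ((rootPoly n).eval u) := by
  induction n with
  | zero =>
    simp only [rootPoly, add_comp, pow_comp, X_comp, eval_add, eval_pow, eval_X, map_add, map_pow,
      CharTwo.add_sq]
    ring
  | succ n ih =>
    simp only [rootPoly_succ, add_comp, pow_comp, mul_comp, C_comp, ih, eval_add, eval_pow,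
      eval_mul, eval_C, map_add, map_pow, map_mul, CharTwo.add_sq]
    ring

theorem rootPoly_eval_add (n : ℕ) (u v : K) :
    (rootPoly n).eval (u + v) = (rootPoly n).eval u + (rootPoly n).eval v := by
  have := congrArg (eval u) (rootPoly_comp n v)
  simpa using this

/-- Raising the degree bound adds one translate by `mono n`, and additivity turns the new product
into `e (e + e(mono n))`. -/
theorem prod_lowDegree (n : ℕ) :
    ∏ a ∈ lowDegree n, (X + C (algebraMap A K a)) = rootPoly n := by
  classical
  induction n with
  | zero =>
    rw [lowDegree, Finset.prod_pair zero_ne_one, rootPoly]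
    simp only [map_zero, map_one, add_zero]
    ring
  | succ n ih =>
    have h : ∏ a ∈ lowDegree n, (X + C (algebraMap A K (a + mono n))) =
        rootPoly n + C (rootVal n) := by
      rw [rootVal, ← rootPoly_comp, ← ih, prod_comp]
      refine Finset.prod_congr rfl fun a _ => ?_
      simp only [add_comp, X_comp, C_comp, map_add]
      ring
    rw [lowDegree, Finset.prod_union (disjoint_lowDegree n),
      Finset.prod_image fun a _ b _ h => add_right_cancel h, ih, h, rootPoly_succ]
    ring

theorem rootPoly_eval_eq_zero {n : ℕ} {a : A} (ha : a ∈ lowDegree n) :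
    (rootPoly n).eval (algebraMap A K a) = 0 := by
  rw [← prod_lowDegree, eval_prod]
  exact Finset.prod_eq_zero ha (by simp [CharTwo.add_self_eq_zero])

theorem add_mono_ne_zero {n : ℕ} {a : A} (ha : a ∈ lowDegree n) : a + mono n ≠ 0 := by
  intro h
  have := degN_add_eq (mem_lowDegree.1 ha) (degN_mono n)
  rw [h, degN_zero] at this
  exact WithBot.bot_ne_coe this

theorem prod_add_mono (n : ℕ) :
    ∏ a ∈ lowDegree n, (algebraMap A K (a + mono n)) = rootVal n := by
  rw [rootVal, ← prod_lowDegree, eval_prod]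
  refine Finset.prod_congr rfl fun a _ => ?_
  simp [add_comm]

theorem rootVal_ne_zero (n : ℕ) : rootVal n ≠ 0 := by
  rw [← prod_add_mono]
  exact Finset.prod_ne_zero_iff.2 fun a ha => algebraMap_ne_zero (add_mono_ne_zero ha)

theorem card_lowDegree (n : ℕ) : (lowDegree n).card = 2 ^ (n + 1) := by
  classical
  induction n with
  | zero => rw [lowDegree, Finset.card_pair zero_ne_one]; rfl
  | succ n ih =>
    rw [lowDegree, Finset.card_union_of_disjoint (disjoint_lowDegree n),
      Finset.card_image_of_injective _ (add_left_injective _), ih]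
    ring

theorem rootPoly_monic (n : ℕ) : (rootPoly n).Monic := by
  rw [← prod_lowDegree]
  exact monic_prod_of_monic _ _ fun a _ => monic_X_add_C _

theorem natDegree_rootPoly (n : ℕ) : (rootPoly n).natDegree = 2 ^ (n + 1) := by
  rw [← prod_lowDegree, natDegree_prod_of_monic _ _ fun a _ => monic_X_add_C _]
  simp [card_lowDegree]

theorem coeff_sq_of_charTwo {F : Type*} [Field F] [CharP F 2] (p : F[X]) :
    (p ^ 2).coeff 0 = p.coeff 0 ^ 2 ∧ (p ^ 2).coeff 1 = 0 ∧ (p ^ 2).coeff 2 = p.coeff 1 ^ 2 ∧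
      (p ^ 2).coeff 3 = 0 := by
  have h2 : (2 : F) = 0 := CharTwo.two_eq_zero
  simp only [pow_two, coeff_mul, Finset.Nat.antidiagonal_succ, Finset.sum_cons,
    Finset.Nat.antidiagonal_zero, Finset.map_singleton, Finset.sum_singleton,
    Finset.map_cons]
  simp
  refine ⟨?_, ?_, ?_⟩ <;> grind

theorem rootPoly_coeff_one_succ (n : ℕ) :
    (rootPoly (n + 1)).coeff 1 = rootVal n * (rootPoly n).coeff 1 := by
  simp [rootPoly_succ, coeff_sq_of_charTwo]

theorem rootPoly_coeff_two_succ (n : ℕ) :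
    (rootPoly (n + 1)).coeff 2 = (rootPoly n).coeff 1 ^ 2 + rootVal n * (rootPoly n).coeff 2 := by
  simp [rootPoly_succ, coeff_sq_of_charTwo]

/-- Additive polynomials have only exponents `2^i`; this removes the cubic term from Newton's
identity for `S_d(3)`. -/
theorem rootPoly_coeff_three (n : ℕ) : (rootPoly n).coeff 3 = 0 := by
  induction n with
  | zero => simp [rootPoly, coeff_X]
  | succ n ih => simp [rootPoly_succ, coeff_sq_of_charTwo, ih]

theorem rootPoly_coeff_one_ne_zero (n : ℕ) : (rootPoly n).coeff 1 ≠ 0 := by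
  induction n with
  | zero => simp [rootPoly]
  | succ n ih =>
    rw [rootPoly_coeff_one_succ]
    exact mul_ne_zero (rootVal_ne_zero n) ih

/-! ### Power sums through the root polynomials -/

/-- Newton's identities for the first and third power sums in characteristic two. -/
theorem newton_charTwo {ι F : Type*} [Field F] [CharP F 2] (s : Finset ι) (u : ι → F) :
    (∏ i ∈ s, (1 + C (u i) * X)).coeff 0 = 1 ∧
    ∑ i ∈ s, u i = (∏ i ∈ s, (1 + C (u i) * X)).coeff 1 ∧
    ∑ i ∈ s, u i ^ 3 = (∏ i ∈ s, (1 + C (u i) * X)).coeff 1 ^ 3 +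
      (∏ i ∈ s, (1 + C (u i) * X)).coeff 1 * (∏ i ∈ s, (1 + C (u i) * X)).coeff 2 +
      (∏ i ∈ s, (1 + C (u i) * X)).coeff 3 := by
  classical
  induction s using Finset.induction_on with
  | empty => simp [coeff_one]
  | insert i s hi ih =>
    rw [Finset.prod_insert hi, Finset.sum_insert hi, Finset.sum_insert hi]
    generalize ∏ i ∈ s, (1 + C (u i) * X) = P at ih
    obtain ⟨h0, h1, h3⟩ := ih
    have hs : ∀ k, ((1 + C (u i) * X) * P).coeff (k + 1) = P.coeff (k + 1) + u i * P.coeff k := by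
      intro k
      rw [add_mul, one_mul, coeff_add, mul_assoc, coeff_C_mul, coeff_X_mul]
    refine ⟨?_, ?_, ?_⟩
    · simp [add_mul, mul_assoc, h0]
    · rw [hs 0, h0, h1]; ring
    · rw [h3, hs 0, hs 1, hs 2, h0, zero_add]
      generalize P.coeff 1 = a
      generalize P.coeff (1 + 1) = b
      generalize P.coeff (2 + 1) = c
      clear * -
      grind

/-- The product over `u = 1/(a + mono n)` is `e(X + mono n)/e(mono n) = 1 + e(X)/e(mono n)`, so the
coefficients of `e` give the elementary symmetric functions of the reciprocals. -/
theorem prod_one_add (n : ℕ) :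
    C (rootVal n) * ∏ a ∈ lowDegree n, (1 + C (1 / algebraMap A K (a + mono n)) * X) =
      rootPoly n + C (rootVal n) := by
  have h : ∏ a ∈ lowDegree n, (X + C (algebraMap A K (a + mono n))) =
      rootPoly n + C (rootVal n) := by
    rw [rootVal, ← rootPoly_comp, ← prod_lowDegree, prod_comp]
    refine Finset.prod_congr rfl fun a _ => ?_
    simp only [add_comp, X_comp, C_comp, map_add]
    ring
  rw [← h, ← prod_add_mono, map_prod, ← Finset.prod_mul_distrib]
  refine Finset.prod_congr rfl fun a ha => ?_
  rw [mul_add, mul_one, ← mul_assoc, ← C_mul,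
    mul_one_div_cancel (algebraMap_ne_zero (add_mono_ne_zero ha)), C_1, one_mul, add_comm]

theorem powerSum_eq (n : ℕ) :
    powerSum (n + 2) 1 = (rootPoly n).coeff 1 / rootVal n ∧
    powerSum (n + 2) 3 = powerSum (n + 2) 1 ^ 3 +
      powerSum (n + 2) 1 * ((rootPoly n).coeff 2 / rootVal n) := by
  have hD := rootVal_ne_zero n
  obtain ⟨-, h1, h3⟩ := newton_charTwo (lowDegree n) fun a => 1 / algebraMap A K (a + mono n)
  have hP := prod_one_add n
  have hc : ∀ k, k ≠ 0 →
      (∏ a ∈ lowDegree n, (1 + C (1 / algebraMap A K (a + mono n)) * X)).coeff k =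
        (rootPoly n).coeff k / rootVal n := by
    intro k hk
    have := congrArg (fun p => coeff p k) hP
    simp only [coeff_C_mul, coeff_add, coeff_C_of_ne_zero hk, add_zero] at this
    rw [eq_div_iff hD, mul_comm, this]
  rw [hc 1 one_ne_zero] at h1 h3
  rw [hc 2 two_ne_zero, hc 3 three_ne_zero, rootPoly_coeff_three, zero_div, add_zero] at h3
  have e1 : powerSum (n + 2) 1 = (rootPoly n).coeff 1 / rootVal n := by
    rw [powerSum_add_two, ← h1]
    simp only [pow_one]
  refine ⟨e1, ?_⟩
  rw [e1, ← h3, powerSum_add_two]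
  simp only [div_pow, one_pow]

theorem powerSum_two_mul (d k : ℕ) : powerSum d (2 * k) = powerSum d k ^ 2 := by
  rcases d with _ | _ | n
  · simp [powerSum_zero]
  · simp [powerSum_one]
  · rw [powerSum_add_two, powerSum_add_two, CharTwo.sum_sq]
    simp only [div_pow, one_pow, ← pow_mul, mul_comm k]

/-- By the recursion of `rootPoly`, the ratio of the two coefficients grows at each step by
`e₁/rootVal n`, which is the power sum. -/
theorem sumLT_eq (n : ℕ) : sumLT [1] (n + 2) = (rootPoly n).coeff 2 / (rootPoly n).coeff 1 := by
  induction n with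
  | zero => rw [sumLT_singleton_two]; simp [rootPoly, coeff_X]
  | succ n ih =>
    have hD := rootVal_ne_zero n
    have h1 := rootPoly_coeff_one_ne_zero n
    rw [show n + 1 + 2 = (n + 2) + 1 from rfl, sumLT_singleton_succ, ih, (powerSum_eq n).1,
      rootPoly_coeff_one_succ, rootPoly_coeff_two_succ]
    field_simp
    ring

theorem powerSum_three (n : ℕ) :
    powerSum (n + 2) 3 =
      powerSum (n + 2) 1 ^ 2 * (powerSum (n + 2) 1 + sumLT [1] (n + 2)) := by
  have hD := rootVal_ne_zero n
  have h1 := rootPoly_coeff_one_ne_zero n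
  rw [(powerSum_eq n).2, sumLT_eq, (powerSum_eq n).1]
  field_simp

theorem sumLT_two (d : ℕ) : sumLT [2] d = sumLT [1] d ^ 2 := by
  simp only [sumLT, mul_one, CharTwo.sum_sq]
  exact Finset.sum_congr rfl fun i _ => powerSum_two_mul i 1

/-- Telescoping: with `s = S_{<d}(1)` and `S = S_d(1)`, `(s + S)³ + s³ + S²(S + s) = S s²` in
characteristic two. -/
theorem sumLE_eq (d : ℕ) : sumLE 1 [2] d = sumLT [1] (d + 1) ^ 3 + sumLT [3] (d + 1) := by
  induction d with
  | zero =>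
    simp [sumLE, sumAt, sumLT, powerSum_zero, CharTwo.add_self_eq_zero]
  | succ d ih =>
    have h3 : powerSum (d + 1) 3 =
        powerSum (d + 1) 1 ^ 2 * (powerSum (d + 1) 1 + sumLT [1] (d + 1)) := by
      rcases d with _ | n
      · simp [powerSum_one]
      · exact powerSum_three n
    rw [sumLE, Finset.sum_range_succ, ← sumLE, ih, sumAt, sumLT_two, sumLT_singleton_succ 1 (d + 1),
      sumLT_singleton_succ 3 (d + 1), h3]
    generalize powerSum (d + 1) 1 = a
    generalize sumLT [1] (d + 1) = b
    generalize sumLT [3] (d + 1) = c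
    have h2 : (2 : K) = 0 := CharTwo.two_eq_zero
    linear_combination (-(a * b ^ 2) - 2 * a ^ 2 * b - a ^ 3) * h2

/-! ### Non-vanishing of polynomials in `x` -/

/-- The inclusion of `𝔽₂[x]` in `K`. -/
def ofPoly : (ZMod 2)[X] →+* K := (algebraMap A K).comp (algebraMap (ZMod 2)[X] A)

theorem ofPoly_X : ofPoly X = xK := rfl

theorem ofPoly_ne_zero {p : (ZMod 2)[X]} (hp : p ≠ 0) : ofPoly p ≠ 0 := by
  rw [ofPoly, RingHom.comp_apply]
  refine algebraMap_ne_zero ?_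
  rwa [Ne, FaithfulSMul.algebraMap_eq_zero_iff]

theorem ne_zero_of_eval {p : (ZMod 2)[X]} (hp : p.eval 0 = 1) : ofPoly p ≠ 0 := by
  refine ofPoly_ne_zero ?_
  rintro rfl
  simp at hp

theorem xK_pow_add_ne_zero {k m : ℕ} (hk : k ≠ m) : xK ^ k + xK ^ m ≠ 0 := by
  have : xK ^ k + xK ^ m = ofPoly (X ^ k + X ^ m) := by simp [ofPoly_X]
  rw [this]
  refine ofPoly_ne_zero fun h => ?_
  have := congrArg (fun p => coeff p m) h
  simp [coeff_X_pow, hk.symm] at this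

theorem xK_sq_add_ne_zero : xK ^ 2 + xK ≠ 0 := by
  simpa using xK_pow_add_ne_zero (k := 2) (m := 1) (by norm_num)

theorem frob_add_ne_zero (n : ℕ) : xK ^ 2 ^ (n + 1) + xK ≠ 0 := by
  simpa using xK_pow_add_ne_zero (k := 2 ^ (n + 1)) (m := 1)
    (Nat.one_lt_two_pow (by omega)).ne'

/-! ### The coefficients of a Hayes module -/

theorem twistedMul_one {L : Type*} [Field L] (f g : ℕ → L) :
    twistedMul f g 1 = f 0 * g 1 + f 1 * g 0 ^ 2 := by
  simp [twistedMul, Finset.Nat.antidiagonal_succ]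

theorem twistedMul_left {L : Type*} [Field L] (f g : ℕ → L) (hf : ∀ k, 2 < k → f k = 0) (n : ℕ) :
    twistedMul f g (n + 2) = f 0 * g (n + 2) + f 1 * g (n + 1) ^ 2 + f 2 * g n ^ 4 := by
  rw [twistedMul, Finset.Nat.sum_antidiagonal_succ, Finset.Nat.sum_antidiagonal_succ,
    Finset.sum_eq_single (0, n)]
  · norm_num
    ring
  · rintro ⟨i, j⟩ hij h
    rw [Finset.HasAntidiagonal.mem_antidiagonal] at hij
    rw [hf, zero_mul]
    rcases i with _ | i
    · simp only [zero_add] at hij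
      simp [hij] at h
    · omega
  · simp

theorem twistedMul_right {L : Type*} [Field L] (f g : ℕ → L) (hg : ∀ k, 2 < k → g k = 0) (n : ℕ) :
    twistedMul f g (n + 2) = f (n + 2) * g 0 ^ 2 ^ (n + 2) + f (n + 1) * g 1 ^ 2 ^ (n + 1) +
      f n * g 2 ^ 2 ^ n := by
  rw [twistedMul, Finset.Nat.sum_antidiagonal_succ', Finset.Nat.sum_antidiagonal_succ',
    Finset.sum_eq_single (n, 0)]
  · norm_num
    ring
  · rintro ⟨i, j⟩ hij h
    rw [Finset.HasAntidiagonal.mem_antidiagonal] at hij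
    rw [hg, zero_pow (by positivity), mul_zero]
    rcases j with _ | j
    · simp only [add_zero] at hij
      simp [hij] at h
    · omega
  · simp

theorem xA_eq_mono : xA = mono 0 := by
  simp [xA, mono, CoordinateRing.smul]

theorem yA_eq_mono : yA = mono 1 := by
  simp [yA, mono]

theorem mono_ne_zero (n : ℕ) : mono n ≠ 0 := by
  intro h
  have := degN_mono n
  rw [h, degN_zero] at this
  exact WithBot.bot_ne_coe this

theorem deg_mono (n : ℕ) : deg (mono n) = n + 2 := by
  have := degN_mono n
  rw [degN_eq_deg (mono_ne_zero n)] at this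
  exact_mod_cast this

theorem deg_xA : deg xA = 2 := by rw [xA_eq_mono, deg_mono]

theorem deg_yA : deg yA = 3 := by rw [yA_eq_mono, deg_mono]

theorem curve_eq_A : yA * yA + yA = xA * (xA * xA) + xA + 1 := by
  apply FaithfulSMul.algebraMap_injective A K
  simp only [map_add, map_mul, map_one]
  change yK * yK + yK = xK * (xK * xK) + xK + 1
  linear_combination curve_eq

namespace HayesModule

variable {L : Type*} [Field L] [Algebra K L] (ρ : HayesModule L)

/-- The hypotheses of `linear_coeff_unique` are commutation of `ρ_x` and `ρ_y` in `τ`-degrees 1 to 4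
and the curve equation in `τ`-degrees 4 and 5. -/
theorem coeff_xA_one : ρ.coeff xA 1 = algebraMap K L (xK ^ 2 + xK) := by
  have : CharP L 2 := charP_of_injective_algebraMap (algebraMap K L).injective 2
  have hx0 : ρ.coeff xA 0 = algebraMap K L xK := ρ.coeff_at_zero xA
  have hy0 : ρ.coeff yA 0 = algebraMap K L yK := ρ.coeff_at_zero yA
  have hx2 : ρ.coeff xA 2 = 1 := by
    have := ρ.coeff_deg xA (xA_eq_mono ▸ mono_ne_zero 0)
    rwa [deg_xA] at this
  have hy3 : ρ.coeff yA 3 = 1 := by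
    have := ρ.coeff_deg yA (yA_eq_mono ▸ mono_ne_zero 1)
    rwa [deg_yA] at this
  have hx : ∀ k, 2 < k → ρ.coeff xA k = 0 := fun k hk =>
    ρ.coeff_of_deg_lt _ _ (by rwa [deg_xA])
  have hy : ∀ k, 3 < k → ρ.coeff yA k = 0 := fun k hk =>
    ρ.coeff_of_deg_lt _ _ (by rwa [deg_yA])
  have hxx := ρ.coeff_mul xA xA
  have hx3 := ρ.coeff_mul xA (xA * xA)
  have hyy := ρ.coeff_mul yA yA
  have hxy : ∀ n, twistedMul (ρ.coeff xA) (ρ.coeff yA) n =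
      twistedMul (ρ.coeff yA) (ρ.coeff xA) n := fun n => by
    rw [← ρ.coeff_mul, ← ρ.coeff_mul, mul_comm]
  have hcurve : ∀ n, ρ.coeff (yA * yA) n + ρ.coeff yA n =
      ρ.coeff (xA * (xA * xA)) n + ρ.coeff xA n + ρ.coeff 1 n := fun n => by
    rw [← ρ.coeff_add, ← ρ.coeff_add, ← ρ.coeff_add, curve_eq_A]
  simp only [ρ.coeff_one] at hcurve
  have e1 := hxy 1
  have e2 := hxy 2
  have e3 := hxy 3
  have e4 := hxy 4
  have f4 := hcurve 4
  have f5 := hcurve 5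
  rw [hx3, hyy] at f4 f5
  simp only [twistedMul_one] at e1
  simp only [twistedMul_left _ _ hx, twistedMul_right _ _ hx, hxx]
    at e2 e3 e4 f4 f5
  simp only [twistedMul, Finset.Nat.antidiagonal_succ, Finset.sum_cons,
    Finset.Nat.antidiagonal_zero, Finset.map_singleton, Finset.sum_singleton,
    Finset.map_cons] at f4 f5
  have hx3' := hx 3 (by norm_num)
  have hx4' := hx 4 (by norm_num)
  have hx5' := hx 5 (by norm_num)
  have hy4' := hy 4 (by norm_num)
  have hy5' := hy 5 (by norm_num)
  simp [hx0, hx2, hy0, hy3, hx3', hx4', hx5', hy4', hy5'] at e1 e2 e3 e4 f4 f5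
  rw [map_add, map_pow]
  clear hxx hx3 hyy hxy hcurve hx hy
  have hcrv := congrArg (algebraMap K L) curve_eq
  simp only [map_add, map_pow, map_one] at hcrv
  have hw0 := (map_ne_zero (algebraMap K L)).2 xK_sq_add_ne_zero
  rw [map_add, map_pow] at hw0
  have hw1 : (algebraMap K L xK ^ 2 + algebraMap K L xK) ^ 3 +
      (algebraMap K L xK ^ 2 + algebraMap K L xK) + 1 ≠ 0 := by
    have h := (map_ne_zero (algebraMap K L)).2
      (ne_zero_of_eval (p := (X ^ 2 + X) ^ 3 + (X ^ 2 + X) + 1) (by simp))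
    simpa [ofPoly_X] using h
  generalize algebraMap K L xK = x at *
  generalize algebraMap K L yK = y at *
  generalize ρ.coeff xA 1 = x1 at *
  generalize ρ.coeff yA 1 = y1 at *
  generalize ρ.coeff yA 2 = y2 at *
  refine linear_coeff_unique x y x1 y1 y2 hcrv hw0 hw1 ?_ ?_ ?_ ?_ ?_ ?_
  · rw [e1]
  · rw [e2]; ring
  · rw [e3]; ring
  · rw [e4]; ring
  · clear * - f4
    grind
  · clear * - f5
    grind

theorem coeff_xA_zero : ρ.coeff xA 0 = algebraMap K L xK := ρ.coeff_at_zero xA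

theorem coeff_xA_two : ρ.coeff xA 2 = 1 := by
  have := ρ.coeff_deg xA (xA_eq_mono ▸ mono_ne_zero 0)
  rwa [deg_xA] at this

theorem coeff_xA_of_lt (k : ℕ) (hk : 2 < k) : ρ.coeff xA k = 0 :=
  ρ.coeff_of_deg_lt _ _ (by rwa [deg_xA])

end HayesModule

/-! ### The coefficients of a Hayes module as additive polynomials -/

/-- The polynomial taking at `a ∈ A` the coefficient of `τ ^ n` in `ρ_a` as value. -/
def coeffPoly : ℕ → K[X]
  | 0 => X
  | 1 => X ^ 2 + X
  | n + 2 => C ((xK ^ 2 ^ (n + 2) + xK)⁻¹) * (C (xK ^ 2 + xK) * coeffPoly (n + 1) ^ 2 +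
      (coeffPoly n ^ 2) ^ 2 + C ((xK ^ 2 + xK) ^ 2 ^ (n + 1)) * coeffPoly (n + 1) + coeffPoly n)

/-- The `τ^(n+2)`-coefficient of `ρ_x ρ_a = ρ_a ρ_x`, freed of denominators. -/
theorem coeffPoly_add_two (n : ℕ) : C (xK ^ 2 ^ (n + 2) + xK) * coeffPoly (n + 2) =
    C (xK ^ 2 + xK) * coeffPoly (n + 1) ^ 2 + (coeffPoly n ^ 2) ^ 2 +
      C ((xK ^ 2 + xK) ^ 2 ^ (n + 1)) * coeffPoly (n + 1) + coeffPoly n := by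
  rw [coeffPoly, ← mul_assoc, ← C_mul, mul_inv_cancel₀ (frob_add_ne_zero (n + 1)), C_1, one_mul]

theorem natDegree_coeffPoly (n : ℕ) : (coeffPoly n).natDegree ≤ 2 ^ n := by
  have H : ∀ n, (coeffPoly n).natDegree ≤ 2 ^ n ∧ (coeffPoly (n + 1)).natDegree ≤ 2 ^ (n + 1) := by
    intro n
    induction n with
    | zero =>
      refine ⟨by simp [coeffPoly], ?_⟩
      rw [zero_add, coeffPoly]
      compute_degree
      norm_num
    | succ n ih =>
      refine ⟨ih.2, ?_⟩
      have h0 := ih.1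
      have h1 := ih.2
      rw [show n + 1 + 1 = n + 2 from rfl, coeffPoly]
      have e : 2 ^ (n + 2) = 4 * 2 ^ n := by ring
      have e' : 2 ^ (n + 1) = 2 * 2 ^ n := by ring
      refine (natDegree_C_mul_le _ _).trans ?_
      refine natDegree_add_le_of_degree_le (natDegree_add_le_of_degree_le
        (natDegree_add_le_of_degree_le ((natDegree_C_mul_le _ _).trans ?_) ?_)
        ((natDegree_C_mul_le _ _).trans ?_)) ?_
      · exact natDegree_pow_le.trans (by omega)
      · have := natDegree_pow_le (p := coeffPoly n) (n := 2)
        exact natDegree_pow_le.trans (by omega)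
      · omega
      · omega
  exact (H n).1

theorem HayesModule.coeff_eq_eval {L : Type*} [Field L] [Algebra K L] (ρ : HayesModule L) (a : A)
    (n : ℕ) : ρ.coeff a n = algebraMap K L ((coeffPoly n).eval (algebraMap A K a)) := by
  have : CharP L 2 := charP_of_injective_algebraMap (algebraMap K L).injective 2
  have comm : ∀ n, twistedMul (ρ.coeff xA) (ρ.coeff a) n =
      twistedMul (ρ.coeff a) (ρ.coeff xA) n := fun n => by
    rw [← ρ.coeff_mul, ← ρ.coeff_mul, mul_comm]
  have H : ∀ n, ρ.coeff a n = algebraMap K L ((coeffPoly n).eval (algebraMap A K a)) ∧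
      ρ.coeff a (n + 1) = algebraMap K L ((coeffPoly (n + 1)).eval (algebraMap A K a)) := by
    intro n
    induction n with
    | zero =>
      have h0 : ρ.coeff a 0 = algebraMap K L ((coeffPoly 0).eval (algebraMap A K a)) := by
        rw [ρ.coeff_at_zero, coeffPoly, eval_X]
      refine ⟨h0, ?_⟩
      have h := comm 1
      rw [twistedMul_one, twistedMul_one, h0, ρ.coeff_xA_zero, ρ.coeff_xA_one] at h
      have hw0 := (map_ne_zero (algebraMap K L)).2 xK_sq_add_ne_zero
      apply mul_left_cancel₀ hw0
      rw [zero_add]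
      simp only [coeffPoly, eval_add, eval_pow, eval_X, map_add, map_pow] at h ⊢
      clear * - h
      grind
    | succ n ih =>
      refine ⟨ih.2, ?_⟩
      have h := comm (n + 2)
      rw [twistedMul_left _ _ ρ.coeff_xA_of_lt, twistedMul_right _ _ ρ.coeff_xA_of_lt, ih.1, ih.2,
        ρ.coeff_xA_zero, ρ.coeff_xA_one, ρ.coeff_xA_two, one_pow, mul_one, one_mul] at h
      have hw0 := (map_ne_zero (algebraMap K L)).2 (frob_add_ne_zero (n + 1))
      apply mul_left_cancel₀ hw0
      have e := congrArg (fun p => algebraMap K L (p.eval (algebraMap A K a))) (coeffPoly_add_two n)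
      simp only [eval_add, eval_mul, eval_C, eval_pow] at e
      rw [map_mul] at e
      rw [show n + 1 + 1 = n + 2 from rfl, e]
      simp only [map_add, map_mul, map_pow] at h ⊢
      generalize algebraMap K L xK ^ 2 ^ (n + 2) = x2 at *
      generalize (algebraMap K L xK ^ 2 + algebraMap K L xK) ^ 2 ^ (n + 1) = w1 at *
      clear * - h
      grind
  exact (H n).1

/-! ### The logarithm coefficients and their relation to `S_{≤n}(1)` -/

/-- The coefficients of the logarithm, in `K`. -/
def logK (n : ℕ) : K := (coeffPoly n).coeff 1

theorem logK_zero : logK 0 = 1 := by simp [logK, coeffPoly]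

theorem logK_one : logK 1 = 1 := by simp [logK, coeffPoly]

theorem logK_add_two (n : ℕ) : (xK ^ 2 ^ (n + 2) + xK) * logK (n + 2) =
    (xK ^ 2 + xK) ^ 2 ^ (n + 1) * logK (n + 1) + logK n := by
  have := congrArg (fun p => coeff p 1) (coeffPoly_add_two n)
  simpa only [coeff_C_mul, coeff_add, coeff_sq_of_charTwo, mul_zero, zero_add, logK] using this

/-- Formally `ρ_a = exp ∘ a ∘ log`, so the coefficient of `a²` is `e₁ l_n²` with `e₁ = -l₁ = 1`. The
proof checks that both sides obey the same recurrence. -/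
theorem coeffPoly_coeff_two (n : ℕ) : (coeffPoly (n + 1)).coeff 2 = logK n ^ 2 := by
  have hrec : ∀ n, (xK ^ 2 ^ (n + 2) + xK) * (coeffPoly (n + 2)).coeff 2 =
      (xK ^ 2 + xK) * logK (n + 1) ^ 2 +
      (xK ^ 2 + xK) ^ 2 ^ (n + 1) * (coeffPoly (n + 1)).coeff 2 + (coeffPoly n).coeff 2 := by
    intro n
    have := congrArg (fun p => coeff p 2) (coeffPoly_add_two n)
    simp only [coeff_C_mul, coeff_add, coeff_sq_of_charTwo] at this
    rw [this, logK]
    ring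
  have h1 : (coeffPoly 1).coeff 2 = logK 0 ^ 2 := by simp [coeffPoly, logK_zero, coeff_X]
  have h2 : (coeffPoly 2).coeff 2 = logK 1 ^ 2 := by
    apply mul_left_cancel₀ (frob_add_ne_zero 1)
    rw [hrec 0, h1, logK_zero, zero_add, logK_one, show (coeffPoly 0).coeff 2 = 0 by
      simp [coeffPoly, coeff_X]]
    clear * -
    norm_num
    generalize xK = x
    grind
  have H : ∀ n, (coeffPoly (n + 1)).coeff 2 = logK n ^ 2 ∧
      (coeffPoly (n + 2)).coeff 2 = logK (n + 1) ^ 2 := by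
    intro n
    induction n with
    | zero => exact ⟨h1, h2⟩
    | succ n ih =>
      refine ⟨ih.2, ?_⟩
      apply mul_left_cancel₀ (frob_add_ne_zero (n + 2))
      have h := congrArg (· ^ 2) (logK_add_two n)
      rw [hrec (n + 1), ih.1, ih.2]
      simp only [mul_pow, CharTwo.add_sq] at h
      rw [← pow_mul, ← pow_succ, ← pow_mul, ← pow_succ] at h
      rw [show n + 1 + 1 = n + 2 from rfl, show n + 1 + 2 = n + 2 + 1 from rfl]
      generalize xK ^ 2 ^ (n + 2 + 1) = x2 at *
      generalize (xK ^ 2 + xK) ^ 2 ^ (n + 2) = w1 at *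
      clear * - h
      grind
  exact (H n).1

/-- The linear terms of `coeffPoly` satisfy the recurrence that `log ∘ ρ_x = x log` imposes. -/
theorem HayesModule.logCoeff_eq {L : Type*} [Field L] [Algebra K L] (ρ : HayesModule L) (n : ℕ) :
    ρ.logCoeff n = algebraMap K L (logK n) := by
  have : CharP L 2 := charP_of_injective_algebraMap (algebraMap K L).injective 2
  obtain ⟨h0, h⟩ : ρ.IsLog ρ.logCoeff := ρ.existsUnique_isLog.choose_spec.1
  have H : ∀ n, ρ.logCoeff n = algebraMap K L (logK n) ∧
      ρ.logCoeff (n + 1) = algebraMap K L (logK (n + 1)) := by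
    intro n
    induction n with
    | zero =>
      refine ⟨by rw [h0, logK_zero, map_one], ?_⟩
      have h1 := h xA 1
      rw [twistedMul_one, h0, ρ.coeff_xA_zero, ρ.coeff_xA_one, one_mul] at h1
      have hw0 := (map_ne_zero (algebraMap K L)).2 xK_sq_add_ne_zero
      apply mul_left_cancel₀ hw0
      rw [zero_add, logK_one, map_one]
      change _ = algebraMap K L xK * _ at h1
      simp only [map_add, map_pow] at h1 ⊢
      clear * - h1
      grind
    | succ n ih =>
      refine ⟨ih.2, ?_⟩
      have h1 := h xA (n + 2)
      rw [twistedMul_right _ _ ρ.coeff_xA_of_lt, ih.1, ih.2,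
        ρ.coeff_xA_zero, ρ.coeff_xA_one, ρ.coeff_xA_two, one_pow, mul_one] at h1
      change _ = algebraMap K L xK * _ at h1
      have hw0 := (map_ne_zero (algebraMap K L)).2 (frob_add_ne_zero (n + 1))
      apply mul_left_cancel₀ hw0
      have e := congrArg (algebraMap K L) (logK_add_two n)
      rw [map_mul] at e
      rw [show n + 1 + 1 = n + 2 from rfl, e]
      simp only [map_add, map_mul, map_pow] at h1 ⊢
      generalize algebraMap K L xK ^ 2 ^ (n + 2) = x2 at *
      generalize (algebraMap K L xK ^ 2 + algebraMap K L xK) ^ 2 ^ (n + 1) = w1 at *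
      clear * - h1
      grind
  exact (H n).1

theorem HayesModule.coeffPoly_eval_eq_zero {L : Type*} [Field L] [Algebra K L] (ρ : HayesModule L)
    {n : ℕ} {a : A} (ha : a ∈ lowDegree n) :
    (coeffPoly (n + 2)).eval (algebraMap A K a) = 0 := by
  apply (algebraMap K L).injective
  rw [← ρ.coeff_eq_eval, map_zero]
  refine ρ.coeff_of_deg_lt _ _ ?_
  rcases eq_or_ne a 0 with rfl | h0
  · rw [deg, degree_eq_bot.1 degN_zero, natDegree_zero]
    omega
  · have := mem_lowDegree.1 ha
    rw [degN_eq_deg h0] at this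
    exact_mod_cast this

theorem HayesModule.coeffPoly_eval_eq_one {L : Type*} [Field L] [Algebra K L] (ρ : HayesModule L)
    {n : ℕ} {a : A} (ha : degN a = (n + 2 : ℕ)) :
    (coeffPoly (n + 2)).eval (algebraMap A K a) = 1 := by
  apply (algebraMap K L).injective
  obtain ⟨h0, h⟩ := mem_monicOfDegree_iff.2 ha
  rw [← ρ.coeff_eq_eval, map_one, ← h]
  exact ρ.coeff_deg a h0

/-- The coefficient polynomial is a quadratic additive polynomial in the root polynomial. -/
theorem HayesModule.coeffPoly_eq {L : Type*} [Field L] [Algebra K L] (ρ : HayesModule L) (n : ℕ) :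
    ∃ α β : K, α * rootVal n ^ 2 + β * rootVal n = 1 ∧
      coeffPoly (n + 2) = C α * rootPoly n ^ 2 + C β * rootPoly n := by
  have hD := rootVal_ne_zero n
  -- `α` matches the top coefficient and `β` makes the value 1 in degree `n + 2`.
  set α := (coeffPoly (n + 2)).coeff (2 ^ (n + 2)) with hα
  set β := (1 + α * rootVal n ^ 2) / rootVal n with hβ
  have h1 : α * rootVal n ^ 2 + β * rootVal n = 1 := by
    rw [hβ, div_mul_cancel₀ _ hD, add_left_comm, CharTwo.add_self_eq_zero, add_zero]
  refine ⟨α, β, h1, ?_⟩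
  rw [← sub_eq_zero]
  have hsq : (rootPoly n ^ 2).natDegree = 2 ^ (n + 2) := by
    rw [natDegree_pow, natDegree_rootPoly]
    ring
  have hlt : 2 ^ (n + 1) < 2 ^ (n + 2) := Nat.pow_lt_pow_right (by norm_num) (by omega)
  have hdeg : (coeffPoly (n + 2) - (C α * rootPoly n ^ 2 + C β * rootPoly n)).natDegree ≤
      2 ^ (n + 2) := by
    refine (natDegree_sub_le_of_le (natDegree_coeffPoly _)
      (natDegree_add_le_of_degree_le (n := 2 ^ (n + 2)) ?_ ?_)).trans_eq (max_self _)
    · exact (natDegree_C_mul_le _ _).trans hsq.le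
    · exact (natDegree_C_mul_le _ _).trans ((natDegree_rootPoly n).trans_lt hlt).le
  have htop : (coeffPoly (n + 2) - (C α * rootPoly n ^ 2 + C β * rootPoly n)).coeff
      (2 ^ (n + 2)) = 0 := by
    have hm : (rootPoly n ^ 2).coeff (2 ^ (n + 2)) = 1 := by
      rw [← hsq]
      exact ((rootPoly_monic n).pow 2).coeff_natDegree
    have hz : (rootPoly n).coeff (2 ^ (n + 2)) = 0 :=
      coeff_eq_zero_of_natDegree_lt ((natDegree_rootPoly n).trans_lt hlt)
    rw [coeff_sub, Polynomial.coeff_add, coeff_C_mul, coeff_C_mul, hm, hz, ← hα]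
    ring
  have heval : ∀ a ∈ lowDegree (n + 1),
      (coeffPoly (n + 2) - (C α * rootPoly n ^ 2 + C β * rootPoly n)).eval
        (algebraMap A K a) = 0 := by
    intro a ha
    simp only [eval_sub, eval_add, eval_mul, eval_C, eval_pow]
    classical
    rw [lowDegree, Finset.mem_union, Finset.mem_image] at ha
    rcases ha with ha | ⟨b, hb, rfl⟩
    · rw [ρ.coeffPoly_eval_eq_zero ha, rootPoly_eval_eq_zero ha]
      ring
    · rw [ρ.coeffPoly_eval_eq_one (degN_add_eq (mem_lowDegree.1 hb) (degN_mono n)), map_add,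
        rootPoly_eval_add, rootPoly_eval_eq_zero hb, zero_add, ← rootVal, h1, sub_self]
  by_contra hne
  classical
  -- The difference has degree below `2^(n+2)` but vanishes at the `2^(n+2)` elements of `lowDegree
  -- (n + 1)`.
  refine hne (eq_zero_of_natDegree_lt_card_of_eval_eq_zero' _
    ((lowDegree (n + 1)).image (algebraMap A K)) (fun z hz => ?_) ?_)
  · obtain ⟨a, ha, rfl⟩ := Finset.mem_image.1 hz
    exact heval a ha
  · rw [Finset.card_image_of_injective _ (FaithfulSMul.algebraMap_injective A K), card_lowDegree]
    refine lt_of_le_of_ne hdeg fun h => hne ?_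
    rw [← leadingCoeff_eq_zero, leadingCoeff, h]
    exact htop

/-- The logarithm coefficients are the partial sums of the zeta value at `1`. -/
theorem HayesModule.logK_eq_sumLT {L : Type*} [Field L] [Algebra K L] (ρ : HayesModule L) (n : ℕ) :
    logK n = sumLT [1] (n + 1) := by
  have H : ∀ n, logK (n + 1) = sumLT [1] (n + 2) := by
    intro n
    induction n with
    | zero => rw [zero_add, logK_one, zero_add, sumLT_singleton_two]
    | succ n ih =>
      obtain ⟨α, β, h1, hE⟩ := ρ.coeffPoly_eq n
      have hl : logK (n + 2) = β * (rootPoly n).coeff 1 := by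
        rw [logK, hE]
        simp [coeff_sq_of_charTwo]
      have h2 : logK (n + 1) ^ 2 =
          α * (rootPoly n).coeff 1 ^ 2 + β * (rootPoly n).coeff 2 := by
        rw [← coeffPoly_coeff_two, hE]
        simp [coeff_sq_of_charTwo]
      have hD := rootVal_ne_zero n
      have hc := rootPoly_coeff_one_ne_zero n
      have hS := (powerSum_eq n).1
      have hs := sumLT_eq n
      have hne := sumLT_ne_zero (n + 1)
      rw [show n + 1 + 2 = n + 2 + 1 from rfl, sumLT_singleton_succ] at hne ⊢
      rw [show n + 1 + 1 = n + 2 from rfl]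
      rw [ih] at h2
      rw [eq_div_iff hD] at hS
      rw [eq_div_iff hc] at hs
      -- Eliminating `α` and `β` yields `(S + s) l = (S + s)²`, and `S + s ≠ 0`.
      apply mul_left_cancel₀ hne
      generalize sumLT [1] (n + 2) = s at *
      generalize powerSum (n + 2) 1 = S at *
      generalize logK (n + 2) = l at *
      generalize (rootPoly n).coeff 1 = c at *
      generalize (rootPoly n).coeff 2 = c' at *
      generalize rootVal n = D at *
      have e : S ^ 2 + l * S + l * s = s ^ 2 := by
        have h3 : α * c ^ 2 + β * c * S = S ^ 2 := by
          rw [← hS]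
          linear_combination S ^ 2 * h1
        rw [h2, ← h3, hl, ← hs]
        clear * -
        grind
      clear * - e
      grind
  rcases n with _ | n
  · rw [logK_zero]
    simp [sumLT, powerSum_zero]
  · exact H n

/-! ### Specialization is compatible with the field operations -/

/-- The rational function `f` specializes to `v ∈ K` on the graph of the `d`-th Frobenius. -/
def HasSpec (d : ℕ) (f : KK) (v : K) : Prop :=
  ∃ p q : (curve K).CoordinateRing, evalGraph d q ≠ 0 ∧
    f = algebraMap _ KK p / algebraMap _ KK q ∧ v = evalGraph d p / evalGraph d q

namespace HasSpec

variable {d : ℕ} {f g : KK} {v w : K}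

theorem specializesTo {L : Type*} [Field L] [Algebra K L] (h : HasSpec d f v) {u : L}
    (hu : u = algebraMap K L v) : SpecializesTo d f u := by
  obtain ⟨p, q, hq, rfl, rfl⟩ := h
  exact ⟨p, q, hq, rfl, hu⟩

theorem algebraMap_ne_zero {q : (curve K).CoordinateRing} (hq : evalGraph d q ≠ 0) :
    algebraMap (curve K).CoordinateRing KK q ≠ 0 := by
  rw [Ne, FaithfulSMul.algebraMap_eq_zero_iff]
  rintro rfl
  exact hq (map_zero _)

theorem of_ring (p : (curve K).CoordinateRing) :
    HasSpec d (algebraMap _ KK p) (evalGraph d p) :=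
  ⟨p, 1, by rw [map_one]; exact one_ne_zero, by simp, by simp⟩

theorem one : HasSpec d 1 1 := by
  simpa using of_ring (d := d) 1

theorem add (hf : HasSpec d f v) (hg : HasSpec d g w) : HasSpec d (f + g) (v + w) := by
  obtain ⟨p, q, hq, rfl, rfl⟩ := hf
  obtain ⟨r, s, hs, rfl, rfl⟩ := hg
  refine ⟨p * s + q * r, q * s, by rw [map_mul]; exact mul_ne_zero hq hs, ?_, ?_⟩
  · rw [div_add_div _ _ (algebraMap_ne_zero hq) (algebraMap_ne_zero hs)]
    simp only [map_add, map_mul]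
  · rw [div_add_div _ _ hq hs]
    simp only [map_add, map_mul]

theorem mul (hf : HasSpec d f v) (hg : HasSpec d g w) : HasSpec d (f * g) (v * w) := by
  obtain ⟨p, q, hq, rfl, rfl⟩ := hf
  obtain ⟨r, s, hs, rfl, rfl⟩ := hg
  refine ⟨p * r, q * s, by rw [map_mul]; exact mul_ne_zero hq hs, ?_, ?_⟩
  · rw [div_mul_div_comm, map_mul, map_mul]
  · rw [div_mul_div_comm, map_mul, map_mul]

theorem pow (hf : HasSpec d f v) (n : ℕ) : HasSpec d (f ^ n) (v ^ n) := by
  induction n with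
  | zero => simpa using one
  | succ n ih => rw [pow_succ, pow_succ]; exact ih.mul hf

theorem div (hf : HasSpec d f v) (hg : HasSpec d g w) (hw : w ≠ 0) :
    HasSpec d (f / g) (v / w) := by
  obtain ⟨p, q, hq, rfl, rfl⟩ := hf
  obtain ⟨r, s, hs, rfl, rfl⟩ := hg
  have hr : evalGraph d r ≠ 0 := fun h => hw (by rw [h, zero_div])
  refine ⟨p * s, q * r, by rw [map_mul]; exact mul_ne_zero hq hr, ?_, ?_⟩
  · rw [div_div_div_eq, map_mul, map_mul]
  · rw [div_div_div_eq, map_mul, map_mul]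

end HasSpec

theorem hasSpec_algebraMap (d : ℕ) (c : K) : HasSpec d (algebraMap K KK c) c := by
  have h := HasSpec.of_ring (d := d) (CoordinateRing.mk (curve K) (C (C c)))
  have e : evalGraph d (CoordinateRing.mk (curve K) (C (C c))) = c :=
    (AdjoinRoot.evalEval_mk (evalEval_graph d) _).trans (by simp)
  rw [e] at h
  exact h

theorem hasSpec_XX (d : ℕ) : HasSpec d XX (xK ^ 2 ^ d) := by
  have h := HasSpec.of_ring (d := d) (CoordinateRing.mk (curve K) (C X))
  have e : evalGraph d (CoordinateRing.mk (curve K) (C X)) = xK ^ 2 ^ d :=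
    (AdjoinRoot.evalEval_mk (evalEval_graph d) _).trans (by rw [evalEval_C, eval_X])
  rw [e] at h
  exact h

theorem hasSpec_YY (d : ℕ) : HasSpec d YY (yK ^ 2 ^ d) := by
  have h := HasSpec.of_ring (d := d) (CoordinateRing.mk (curve K) X)
  have e : evalGraph d (CoordinateRing.mk (curve K) X) = yK ^ 2 ^ d :=
    (AdjoinRoot.evalEval_mk (evalEval_graph d) _).trans (by simp)
  rw [e] at h
  exact h

/-! ### Regularity of the explicit functions -/

section

variable {d : ℕ} {fX fY : KK} {X Y : K}

theorem hasSpec_By (hY : HasSpec d fY Y) : HasSpec d (By yy fY) (By yK Y) :=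
  hY.add (hasSpec_algebraMap d yK)

theorem hasSpec_Bx (hX : HasSpec d fX X) : HasSpec d (Bx xx fX) (Bx xK X) :=
  hX.add (hasSpec_algebraMap d xK)

theorem hasSpec_g (hX : HasSpec d fX X) (hY : HasSpec d fY Y) (h : X ^ 2 + xK + 1 ≠ 0) :
    HasSpec d (g xx yy fX fY) (g xK yK X Y) :=
  ((hasSpec_By hY).add (hX.mul (hasSpec_Bx hX))).div ((hasSpec_Bx (hX.pow 2)).add .one) h

theorem hasSpec_CC (hX : HasSpec d fX X) (hY : HasSpec d fY Y) :
    HasSpec d (CC xx yy fX fY) (CC xK yK X Y) :=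
  have hx := hasSpec_algebraMap d xK
  (((hasSpec_By hY).add (hx.mul (hasSpec_Bx hX))).add (hx.pow 2)).add hx

theorem hasSpec_F1 (hX : HasSpec d fX X) (hY : HasSpec d fY Y) (h : CC xK yK X Y ≠ 0) :
    HasSpec d (F1 xx yy fX fY) (F1 xK yK X Y) :=
  (hX.add ((hasSpec_algebraMap d xK).pow 2)).div (hasSpec_CC hX hY) h

theorem hasSpec_FLT1 (hX : HasSpec d fX X) (hY : HasSpec d fY Y) (h : CC xK yK X Y ≠ 0)
    (h' : X ^ 2 + xK + 1 ≠ 0) : HasSpec d (FLT1 xx yy fX fY) (FLT1 xK yK X Y) :=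
  (((hasSpec_g hX hY h').pow 2).add ((hasSpec_F1 hX hY h).pow 2)).add (hasSpec_F1 hX hY h)

theorem hasSpec_F12 (hX : HasSpec d fX X) (hY : HasSpec d fY Y) (h : CC xK yK X Y ≠ 0)
    (h' : X ^ 2 + xK + 1 ≠ 0) : HasSpec d (F12 xx yy fX fY) (F12 xK yK X Y) :=
  (hasSpec_F1 hX hY h).mul ((hasSpec_FLT1 hX hY h h').pow 2)

theorem hasSpec_F3 (hX : HasSpec d fX X) (hY : HasSpec d fY Y) (h : CC xK yK X Y ≠ 0)
    (h' : X ^ 2 + xK + 1 ≠ 0) : HasSpec d (F3 xx yy fX fY) (F3 xK yK X Y) :=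
  ((hasSpec_F1 hX hY h).pow 2).mul
    (((hasSpec_g hX hY h').pow 2).add ((hasSpec_F1 hX hY h).pow 2))

theorem hasSpec_gm (hX : HasSpec d fX X) (hY : HasSpec d fY Y) (h : X ^ 4 + xK ^ 4 + 1 ≠ 0) :
    HasSpec d (gm xx yy fX fY) (gm xK yK X Y) :=
  have hx := hasSpec_algebraMap d xK
  have hy := hasSpec_algebraMap d yK
  (((hY.pow 2).add (hy.pow 4)).add ((hX.pow 2).mul ((hX.pow 2).add (hx.pow 4)))).div
    (((hX.pow 4).add (hx.pow 4)).add .one) h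

theorem hasSpec_A2 (hX : HasSpec d fX X) (hY : HasSpec d fY Y) (h : CC xK yK X Y ≠ 0)
    (h' : X ^ 2 + xK + 1 ≠ 0) (hm : X ^ 4 + xK ^ 4 + 1 ≠ 0) :
    HasSpec d (A2 xx yy fX fY) (A2 xK yK X Y) :=
  have hx := hasSpec_algebraMap d xK
  have hF := hasSpec_F1 hX hY h
  have hg := hasSpec_g hX hY h'
  hF.mul ((((hg.pow 4).mul (hasSpec_gm hX hY hm)).div ((hx.pow 2).add hx) xK_sq_add_ne_zero).add
    (((((hg.pow 2).add (hF.pow 2)).add hF).pow 2).mul ((hF.pow 2).add hF)))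

theorem hasSpec_FLT3 (hX : HasSpec d fX X) (hY : HasSpec d fY Y) (h : CC xK yK X Y ≠ 0)
    (h' : X ^ 2 + xK + 1 ≠ 0) (hm : X ^ 4 + xK ^ 4 + 1 ≠ 0) (hF1 : F1 xK yK X Y ≠ 0) :
    HasSpec d (FLT3 xx yy fX fY) (FLT3 xK yK X Y) :=
  have hF := hasSpec_F1 hX hY h
  have hg := hasSpec_g hX hY h'
  ((hasSpec_A2 hX hY h h' hm).div hF hF1).add ((((hg.pow 2).add (hF.pow 2)).add hF).pow 3)

theorem hasSpec_Cm (hX : HasSpec d fX X) (hY : HasSpec d fY Y) :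
    HasSpec d (Cm xx yy fX fY) (Cm xK yK X Y) :=
  have hx := hasSpec_algebraMap d xK
  have hy := hasSpec_algebraMap d yK
  (((hY.add (hy.pow 2)).add ((hx.pow 2).mul (hX.add (hx.pow 2)))).add (hx.pow 4)).add (hx.pow 2)

theorem xK_ne_zero : xK ≠ 0 := by
  have := ofPoly_ne_zero (p := X) X_ne_zero
  rwa [ofPoly_X] at this

theorem hasSpec_U (hX : HasSpec d fX X) : HasSpec d (U xx fX) (U xK X) :=
  have hx := hasSpec_algebraMap d xK
  (((((hX.add (hx.pow 2)).mul ((hX.pow 3).add ((hX.pow 2).mul hx))).div ((hx.pow 2).add hx)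
    xK_sq_add_ne_zero).add ((hX.pow 2).div hx xK_ne_zero)).add (hX.mul hx)).add .one

theorem hasSpec_FLE12 (hX : HasSpec d fX X) (hY : HasSpec d fY Y) (h : CC xK yK X Y ≠ 0)
    (h' : X ^ 2 + xK + 1 ≠ 0) (h2 : CC xK yK (X ^ 2) (Y ^ 2) ≠ 0)
    (h2' : (X ^ 2) ^ 2 + xK + 1 ≠ 0) (hC : Cm xK yK X Y ≠ 0)
    (h12 : F12 xK yK (X ^ 2) (Y ^ 2) ≠ 0)
    (hJ : 1 + (g xK yK (X ^ 2) (Y ^ 2) ^ 3 * CC xK yK X Y ^ 2 * F12 xK yK X Y) /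
      (Cm xK yK X Y * F12 xK yK (X ^ 2) (Y ^ 2)) ≠ 0) :
    HasSpec d (FLE12 xx yy fX fY) (FLE12 xK yK X Y) :=
  have hF := hasSpec_F12 hX hY h h'
  have hF2 := hasSpec_F12 (hX.pow 2) (hY.pow 2) h2 h2'
  have hg2 := hasSpec_g (hX.pow 2) (hY.pow 2) h2'
  have hCC := hasSpec_CC hX hY
  have hCm := hasSpec_Cm hX hY
  ((((hasSpec_U hX).add (hCC.pow 2)).div (HasSpec.one.add ((((hg2.pow 3).mul (hCC.pow 2)).mul
    hF).div (hCm.mul hF2) (mul_ne_zero hC h12))) hJ).mul hF).div hCm hC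

end

/-! ### The values on the graphs of the powers of Frobenius -/

theorem frob_curve (d : ℕ) :
    (yK ^ 2 ^ d) ^ 2 + yK ^ 2 ^ d = (xK ^ 2 ^ d) ^ 3 + xK ^ 2 ^ d + 1 := by
  have h := congrArg (· ^ 2 ^ d) curve_eq
  simp only [add_pow_char_pow, one_pow] at h
  linear_combination h

theorem xK_frob_ne (d : ℕ) : (xK ^ 2 ^ d) ^ 2 + xK + 1 ≠ 0 := by
  have h := ne_zero_of_eval (p := (X ^ 2 ^ d) ^ 2 + X + 1) (by simp)
  rwa [map_add, map_add, map_pow, map_pow, map_one, ofPoly_X] at h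

theorem xK_frob_ne' (d : ℕ) : (xK ^ 2 ^ d) ^ 4 + xK ^ 4 + 1 ≠ 0 := by
  have h := ne_zero_of_eval (p := (X ^ 2 ^ d) ^ 4 + X ^ 4 + 1) (by simp)
  rwa [map_add, map_add, map_pow, map_pow, map_pow, map_one, ofPoly_X] at h

theorem xK_frob_add_sq_ne (n : ℕ) : xK ^ 2 ^ (n + 2) + xK ^ 2 ≠ 0 :=
  xK_pow_add_ne_zero (Nat.pow_lt_pow_right (a := 2) (m := 1) (by norm_num) (by omega)).ne'

/-- The value of `g` on the graph of the `d`-th power of Frobenius. -/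
def gVal (d : ℕ) : K := g xK yK (xK ^ 2 ^ d) (yK ^ 2 ^ d)

theorem gVal_mul (d : ℕ) : gVal d * ((xK ^ 2 ^ d) ^ 2 + xK + 1) =
    yK ^ 2 ^ d + yK + (xK ^ 2 ^ d) ^ 2 + xK * xK ^ 2 ^ d := by
  simp only [gVal, g, Bx, By]
  rw [div_mul_cancel₀ _ (xK_frob_ne d)]
  ring

theorem frob_succ (z : K) (d : ℕ) : z ^ 2 ^ (d + 1) = (z ^ 2 ^ d) ^ 2 := by
  rw [← pow_mul, ← pow_succ]

theorem gVal_quadratic (d : ℕ) :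
    ((xK ^ 2 ^ d) ^ 2 + xK + 1) * gVal d ^ 2 + gVal d + (xK ^ 2 ^ d) ^ 2 + xK ^ 2 ^ d +
      (xK ^ 2 + xK) = 0 :=
  g_quadratic curve_eq (frob_curve d) (xK_frob_ne d) (gVal_mul d)

theorem gVal_succ_mul (d : ℕ) :
    gVal (d + 1) * ((xK ^ 2 ^ d) ^ 2 + xK ^ 2 ^ d + gVal d) = (xK ^ 2 ^ d) ^ 2 + xK := by
  have h := xK_frob_ne (d + 1)
  have h' := gVal_mul (d + 1)
  rw [frob_succ, frob_succ] at h'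
  rw [frob_succ] at h
  refine g_twist curve_eq (frob_curve d) (xK_frob_ne d) ?_ (gVal_mul d) ?_
  · rwa [← pow_mul] at h
  · rw [← pow_mul (xK ^ 2 ^ d)] at h'
    exact h'

theorem xK_frob_sq_add_ne (d : ℕ) : (xK ^ 2 ^ d) ^ 2 + xK ≠ 0 := by
  rw [← frob_succ]
  exact frob_add_ne_zero d

theorem gVal_succ_ne_zero (d : ℕ) : gVal (d + 1) ≠ 0 := by
  intro h
  have := gVal_succ_mul d
  rw [h, zero_mul] at this
  exact xK_frob_sq_add_ne d this.symm

theorem gVal_shift_ne_zero (d : ℕ) : (xK ^ 2 ^ d) ^ 2 + xK ^ 2 ^ d + gVal d ≠ 0 := by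
  intro h
  have := gVal_succ_mul d
  rw [h, mul_zero] at this
  exact xK_frob_sq_add_ne d this.symm

/-- `g_twist` and the recurrence of `logK` determine the same ratios, starting from `g(1) = 1`. -/
theorem gVal_mul_logK (d : ℕ) : gVal (d + 1) * logK (d + 1) = logK d := by
  induction d with
  | zero =>
    have h := gVal_mul 1
    have h0 := xK_frob_ne 1
    rw [zero_add, logK_one, logK_zero, mul_one]
    apply mul_right_cancel₀ h0
    rw [h, pow_one, one_mul]
    have := curve_eq
    generalize xK = x at *
    generalize yK = y at *
    clear * - this
    grind
  | succ d ih =>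
    have h1 := gVal_succ_mul (d + 1)
    have h2 := logK_add_two d
    have e : (xK ^ 2 + xK) ^ 2 ^ (d + 1) = (xK ^ 2 ^ (d + 1)) ^ 2 + xK ^ 2 ^ (d + 1) := by
      rw [add_pow_char_pow, ← pow_mul, ← pow_mul, mul_comm]
    rw [← ih, e, show d + 2 = (d + 1) + 1 from rfl, frob_succ _ (d + 1)] at h2
    apply mul_left_cancel₀ (xK_frob_sq_add_ne (d + 1))
    linear_combination gVal (d + 1 + 1) * h2 + logK (d + 1) * h1

theorem CC_mul (d : ℕ) : CC xK yK (xK ^ 2 ^ d) (yK ^ 2 ^ d) *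
    (CC xK yK (xK ^ 2 ^ d) (yK ^ 2 ^ d) + 1) =
      (xK ^ 2 ^ d + xK ^ 2) * ((xK ^ 2 ^ d) ^ 2 + xK + 1) := by
  have h := curve_eq
  have H := frob_curve d
  simp only [CC, By, Bx]
  generalize xK ^ 2 ^ d = X at *
  generalize yK ^ 2 ^ d = Y at *
  generalize xK = x at *
  generalize yK = y at *
  clear * - h H
  grind

theorem CC_ne_zero (n : ℕ) : CC xK yK (xK ^ 2 ^ (n + 2)) (yK ^ 2 ^ (n + 2)) ≠ 0 := by
  intro h
  have := CC_mul (n + 2)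
  rw [h, zero_mul] at this
  exact mul_ne_zero (xK_frob_add_sq_ne n) (xK_frob_ne _) this.symm

/-- For `d = 1` the product in `CC_mul` is zero, as `X = x²`, but the vanishing factor is `C + 1`.
This case is needed because `C_m(2) = C(1)²`. -/
theorem CC_one : CC xK yK (xK ^ 2 ^ 1) (yK ^ 2 ^ 1) = 1 := by
  have h := curve_eq
  simp only [CC, By, Bx, pow_one]
  generalize xK = x at *
  generalize yK = y at *
  grind

theorem CC_succ_ne_zero (n : ℕ) : CC xK yK (xK ^ 2 ^ (n + 1)) (yK ^ 2 ^ (n + 1)) ≠ 0 := by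
  rcases n with _ | n
  · rw [zero_add, CC_one]
    exact one_ne_zero
  · exact CC_ne_zero n

theorem Cm_succ (d : ℕ) : Cm xK yK (xK ^ 2 ^ (d + 1)) (yK ^ 2 ^ (d + 1)) =
    CC xK yK (xK ^ 2 ^ d) (yK ^ 2 ^ d) ^ 2 := by
  simp only [Cm, CC, By, Bx, frob_succ]
  generalize xK ^ 2 ^ d = X at *
  generalize yK ^ 2 ^ d = Y at *
  generalize xK = x at *
  generalize yK = y at *
  clear * -
  grind

theorem F1_frob (n : ℕ) :
    F1 xK yK (xK ^ 2 ^ (n + 2)) (yK ^ 2 ^ (n + 2)) = 1 + gVal (n + 2) :=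
  F1_eq curve_eq (frob_curve _) (xK_frob_ne _) (CC_ne_zero n)

theorem one_add_gVal_ne_zero (n : ℕ) : 1 + gVal (n + 2) ≠ 0 := by
  rw [← F1_frob, F1]
  exact div_ne_zero (xK_frob_add_sq_ne n) (CC_ne_zero n)

theorem FLT1_frob (n : ℕ) :
    FLT1 xK yK (xK ^ 2 ^ (n + 2)) (yK ^ 2 ^ (n + 2)) = gVal (n + 2) := by
  rw [FLT1, F1_frob, ← gVal]
  grind

theorem F12_frob (n : ℕ) : F12 xK yK (xK ^ 2 ^ (n + 2)) (yK ^ 2 ^ (n + 2)) =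
    (1 + gVal (n + 2)) * gVal (n + 2) ^ 2 := by
  rw [F12, FLT1_frob, F1_frob]

theorem F3_frob (n : ℕ) : F3 xK yK (xK ^ 2 ^ (n + 2)) (yK ^ 2 ^ (n + 2)) =
    (1 + gVal (n + 2)) ^ 2 := by
  rw [F3, F1_frob, ← gVal]
  grind

theorem gm_frob (d : ℕ) : gVal d ^ 4 * gm xK yK (xK ^ 2 ^ d) (yK ^ 2 ^ d) =
    (xK ^ 2 ^ d) ^ 4 + xK ^ 4 + gVal d ^ 4 * ((xK ^ 2 ^ d) ^ 4 + (xK ^ 2 ^ d) ^ 2) :=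
  gm_eq curve_eq (frob_curve d) (xK_frob_ne d) (xK_frob_ne' d) (gVal_mul d)
    (by rw [gm, div_mul_cancel₀ _ (xK_frob_ne' d)])

/-- Substituting `F_1 = 1 + g` and `F_{<1} = g` collapses `F_{<3}` to `g⁴ (g_m/(x² + x) + 1)`. -/
theorem FLT3_frob (n : ℕ) : FLT3 xK yK (xK ^ 2 ^ (n + 2)) (yK ^ 2 ^ (n + 2)) * (xK ^ 2 + xK) =
    (xK ^ 2 ^ (n + 2)) ^ 4 + xK ^ 4 +
      gVal (n + 2) ^ 4 * ((xK ^ 2 ^ (n + 2)) ^ 4 + (xK ^ 2 ^ (n + 2)) ^ 2 + (xK ^ 2 + xK)) := by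
  have h1 := one_add_gVal_ne_zero n
  have hw := xK_sq_add_ne_zero
  rw [FLT3, A2, F1_frob, ← gVal, gm_frob, mul_div_cancel_left₀ _ h1]
  generalize gVal (n + 2) = g
  generalize xK ^ 2 ^ (n + 2) = X
  have h2 : g ^ 2 + (1 + g) ^ 2 + (1 + g) = g := by
    clear * -
    grind
  rw [h2, add_assoc, add_mul, div_mul_cancel₀ _ hw]
  clear * -
  grind

/-- Comparison with `gm_frob` identifies `g_m(d)` with `g(d-1)⁴`. -/
theorem gVal_prev (n : ℕ) : gVal (n + 2) ^ 4 * gVal (n + 1) ^ 4 =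
    (xK ^ 2 ^ (n + 2)) ^ 4 + xK ^ 4 +
      gVal (n + 2) ^ 4 * ((xK ^ 2 ^ (n + 2)) ^ 4 + (xK ^ 2 ^ (n + 2)) ^ 2) := by
  have h := congrArg (· ^ 4) (gVal_succ_mul (n + 1))
  simp only [show n + 2 = (n + 1) + 1 from rfl, frob_succ _ (n + 1)]
  generalize gVal (n + 1 + 1) = g at *
  generalize gVal (n + 1) = h at *
  generalize xK ^ 2 ^ (n + 1) = X at *
  generalize xK = x at *
  clear * - h
  grind

/-! ### The non-vanishing of `U + C²` -/

/-- Each Frobenius step adds `Y² + Y`, a cubic polynomial in `X = x^(2^d)`. -/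
theorem exists_frob_yK_add (d : ℕ) :
    ∃ p : (ZMod 2)[X], p.natDegree ≤ 3 * 2 ^ d ∧ yK ^ 2 ^ d + yK = ofPoly p := by
  induction d with
  | zero => exact ⟨0, by simp, by simp [CharTwo.add_self_eq_zero]⟩
  | succ d ih =>
    obtain ⟨p, hp, h⟩ := ih
    refine ⟨p + ((X ^ 2 ^ d) ^ 3 + X ^ 2 ^ d + 1), ?_, ?_⟩
    · have e : 2 ^ (d + 1) = 2 * 2 ^ d := by ring
      have : ((X ^ 2 ^ d) ^ 3 + X ^ 2 ^ d + 1 : (ZMod 2)[X]).natDegree ≤ 3 * 2 ^ d := by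
        rw [← pow_mul]
        refine natDegree_add_le_of_degree_le (natDegree_add_le_of_degree_le ?_ ?_) ?_
        · rw [natDegree_X_pow, mul_comm]
        · rw [natDegree_X_pow]; omega
        · rw [natDegree_one]; omega
      refine natDegree_add_le_of_degree_le ?_ ?_ <;> omega
    · have := frob_curve d
      rw [map_add, ← h, frob_succ, map_add, map_add, map_pow, map_pow, map_one, ofPoly_X]
      generalize xK ^ 2 ^ d = X at *
      generalize yK ^ 2 ^ d = Y at *
      clear * - this
      grind

theorem U_mul (X : K) : U xK X * (xK ^ 2 + xK) =
    (X + xK ^ 2) * (X ^ 3 + X ^ 2 * xK) + X ^ 2 * (xK + 1) + X * xK * (xK ^ 2 + xK) +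
      (xK ^ 2 + xK) := by
  have hw := xK_sq_add_ne_zero
  have hx := xK_ne_zero
  have e : X ^ 2 / xK * (xK ^ 2 + xK) = X ^ 2 * (xK + 1) := by
    field_simp
  rw [U, add_mul, add_mul, add_mul, div_mul_cancel₀ _ hw, e, one_mul]

/-- All terms after the first have degree at most `3q + 3 < 4q`, so `X^(4q)` cannot cancel. -/
theorem U_poly_ne_zero {q : ℕ} (hq : 4 ≤ q) {p : (ZMod 2)[X]} (hp : p.natDegree ≤ 3 * q) :
    X ^ (4 * q) + (X ^ (3 * q + 1) + X ^ (3 * q + 2) + X ^ (2 * q + 3) +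
    (X ^ (2 * q + 1) + X ^ (2 * q)) + (X ^ (q + 3) + X ^ (q + 2)) + (X ^ 2 + X) +
    (p + X ^ (3 * q) + X ^ q + X ^ 3 + X + X ^ (2 * q + 2) + X ^ 2) * (X ^ 2 + X)) ≠ 0 := by
  have hRdeg : (X ^ (3 * q + 1) + X ^ (3 * q + 2) + X ^ (2 * q + 3) +
    (X ^ (2 * q + 1) + X ^ (2 * q)) + (X ^ (q + 3) + X ^ (q + 2)) + (X ^ 2 + X) +
    (p + X ^ (3 * q) + X ^ q + X ^ 3 + X + X ^ (2 * q + 2) + X ^ 2) * (X ^ 2 + X) :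
      (ZMod 2)[X]).natDegree ≤ 3 * q + 3 := by
    have hX (k m : ℕ) (hk : k ≤ m) : (X ^ k : (ZMod 2)[X]).natDegree ≤ m := by
      rwa [natDegree_X_pow]
    have add {a b : (ZMod 2)[X]} {m : ℕ} (ha : a.natDegree ≤ m) (hb : b.natDegree ≤ m) :
        (a + b).natDegree ≤ m := natDegree_add_le_of_degree_le ha hb
    have h2 : (X ^ 2 + X : (ZMod 2)[X]).natDegree ≤ 2 := by
      compute_degree
    refine add (add (add (add (add (add ?_ ?_) ?_) (add ?_ ?_)) (add ?_ ?_)) ?_) ?_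
    · exact hX _ _ (by omega)
    · exact hX _ _ (by omega)
    · exact hX _ _ (by omega)
    · exact hX _ _ (by omega)
    · exact hX _ _ (by omega)
    · exact hX _ _ (by omega)
    · exact hX _ _ (by omega)
    · exact h2.trans (by omega)
    · refine (natDegree_mul_le_of_le (m := 3 * q) ?_ h2).trans (by omega)
      refine add (add (add (add (add (add hp ?_) ?_) ?_) ?_) ?_) ?_
      · exact hX _ _ (by omega)
      · exact hX _ _ (by omega)
      · exact hX _ _ (by omega)
      · rw [natDegree_X]; omega
      · exact hX _ _ (by omega)
      · exact hX _ _ (by omega)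
  intro h
  have : coeff _ (4 * q) = coeff _ (4 * q) := congrArg (fun p => coeff p (4 * q)) h
  rw [Polynomial.coeff_add, coeff_X_pow_self, coeff_zero,
    coeff_eq_zero_of_natDegree_lt (by omega)] at this
  simp at this

theorem U_add_CC_sq_ne_zero (n : ℕ) : U xK (xK ^ 2 ^ (n + 2)) +
    CC xK yK (xK ^ 2 ^ (n + 2)) (yK ^ 2 ^ (n + 2)) ^ 2 ≠ 0 := by
  obtain ⟨p, hp, h⟩ := exists_frob_yK_add (n + 2)
  -- The curve equations replace `Y² + y²` by `Y + y` plus cubics, so `C²` is a polynomial in `x`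
  -- alone.
  have hC : CC xK yK (xK ^ 2 ^ (n + 2)) (yK ^ 2 ^ (n + 2)) ^ 2 =
      ofPoly (p + (X ^ 2 ^ (n + 2)) ^ 3 + X ^ 2 ^ (n + 2) + X ^ 3 + X +
        X ^ 2 * (X ^ 2 ^ (n + 2)) ^ 2 + X ^ 2) := by
    have h1 := curve_eq
    have h2 := frob_curve (n + 2)
    simp only [map_add, map_mul, map_pow, ofPoly_X, ← h, CC, By, Bx]
    generalize xK ^ 2 ^ (n + 2) = X at *
    generalize yK ^ 2 ^ (n + 2) = Y at *
    generalize xK = x at *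
    generalize yK = y at *
    clear * - h1 h2
    grind
  intro h0
  have h1 := congrArg (· * (xK ^ 2 + xK)) h0
  simp only [add_mul, zero_mul] at h1
  have hq : 4 ≤ 2 ^ (n + 2) := Nat.pow_le_pow_right (n := 2) (i := 2) (by norm_num) (by omega)
  set q := 2 ^ (n + 2) with hqdef
  set R : (ZMod 2)[X] := X ^ (3 * q + 1) + X ^ (3 * q + 2) + X ^ (2 * q + 3) +
    (X ^ (2 * q + 1) + X ^ (2 * q)) + (X ^ (q + 3) + X ^ (q + 2)) + (X ^ 2 + X) +
    (p + X ^ (3 * q) + X ^ q + X ^ 3 + X + X ^ (2 * q + 2) + X ^ 2) * (X ^ 2 + X) with hR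
  have hz : ofPoly (X ^ (4 * q) + R) = 0 := by
    rw [← h1, ← add_mul, add_mul, U_mul, hC, hR]
    simp only [map_add, map_mul, map_pow, ofPoly_X]
    ring
  refine ofPoly_ne_zero ?_ hz
  exact hR ▸ U_poly_ne_zero hq hp

/-! ### Power sums in terms of the logarithm coefficients -/

namespace HayesModule

variable {L : Type*} [Field L] [Algebra K L]

theorem logK_ne_zero (ρ : HayesModule L) (n : ℕ) : logK n ≠ 0 := by
  rcases n with _ | n
  · rw [logK_zero]
    exact one_ne_zero
  · rw [ρ.logK_eq_sumLT]
    exact sumLT_ne_zero n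

theorem sumLT_one_eq (ρ : HayesModule L) (n : ℕ) :
    sumLT [1] (n + 2) = gVal (n + 2) * logK (n + 2) := by
  rw [← ρ.logK_eq_sumLT, gVal_mul_logK]

theorem powerSum_one_eq (ρ : HayesModule L) (n : ℕ) :
    powerSum (n + 2) 1 = (1 + gVal (n + 2)) * logK (n + 2) := by
  have h := sumLT_singleton_succ 1 (n + 2)
  rw [← ρ.logK_eq_sumLT, ρ.sumLT_one_eq] at h
  rw [add_mul, one_mul]
  nth_rewrite 1 [h]
  rw [add_right_comm, CharTwo.add_self_eq_zero, zero_add]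

theorem powerSum_three_eq (ρ : HayesModule L) (n : ℕ) :
    powerSum (n + 2) 3 = (1 + gVal (n + 2)) ^ 2 * logK (n + 2) ^ 3 := by
  rw [powerSum_three, ρ.powerSum_one_eq, ρ.sumLT_one_eq]
  generalize gVal (n + 2) = g
  generalize logK (n + 2) = l
  grind

/-- Dividing by `l_{n+2}⁴` and using `l_{n+1} = g(n+2) l_{n+2}`, `l_n = g(n+1) l_{n+1}` turns the
right side into the closed form of `F_{<3}`. -/
theorem sumLT_three_mul (ρ : HayesModule L) (n : ℕ) :
    (xK ^ 2 + xK) * sumLT [3] (n + 2) * logK (n + 2) =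
      logK n ^ 4 + (xK ^ 2 + xK) * logK (n + 1) ^ 4 := by
  induction n with
  | zero =>
    have h := logK_add_two 0
    have hw := xK_sq_add_ne_zero
    -- For `w = x² + x` the recurrence reads `w (w + 1) l₂ = (w + 1)²`, from which `w + 1` is
    -- cancelled.
    have hw1 : xK ^ 2 + xK + 1 ≠ 0 := by simpa using xK_frob_ne 0
    rw [zero_add, sumLT_singleton_two, logK_zero, logK_one]
    rw [zero_add, zero_add, logK_zero, logK_one] at h
    apply mul_left_cancel₀ hw1
    norm_num at h ⊢
    generalize logK 2 = l at *
    generalize xK = x at *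
    clear * - h
    grind
  | succ n ih =>
    have hl := ρ.logK_ne_zero (n + 2)
    have hne := xK_frob_sq_add_ne (n + 2)
    have e1 := gVal_mul_logK (n + 1)
    have e2 := gVal_mul_logK (n + 2)
    have e0 := gVal_mul_logK n
    have hg := gVal_succ_mul (n + 2)
    have hp := gVal_prev n
    have hs := sumLT3_step rfl (gVal_quadratic (n + 2))
    rw [show n + 1 + 2 = n + 2 + 1 from rfl, sumLT_singleton_succ, ρ.powerSum_three_eq]
    rw [show n + 1 + 1 = n + 2 from rfl] at e1 ⊢
    apply mul_left_cancel₀ hne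
    apply mul_left_cancel₀ hl
    have hl3 : ((xK ^ 2 ^ (n + 2)) ^ 2 + xK) * logK (n + 2 + 1) =
        ((xK ^ 2 ^ (n + 2)) ^ 2 + xK ^ 2 ^ (n + 2) + gVal (n + 2)) * logK (n + 2) := by
      rw [← hg, ← e2]
      ring
    rw [← e0, ← e1] at ih
    rw [← e1]
    generalize gVal (n + 2 + 1) = g' at *
    generalize gVal (n + 2) = g at *
    generalize gVal (n + 1) = h at *
    generalize logK (n + 2 + 1) = l' at *
    generalize logK (n + 2) = l at *
    generalize sumLT [3] (n + 2) = T at *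
    generalize xK ^ 2 ^ (n + 2) = X at *
    generalize xK = x at *
    linear_combination (x ^ 2 + x) * (T + (1 + g) ^ 2 * l ^ 3) * l * hl3 +
      (X ^ 2 + X + g) * l * ih + l ^ 5 * (X ^ 2 + X + g) * hp - l ^ 5 * hs +
      (x ^ 2 + x) * (X ^ 2 + X + g) * l ^ 5 * g * CharTwo.two_eq_zero (R := K)

theorem sumLT_three_eq (ρ : HayesModule L) (n : ℕ) :
    sumLT [3] (n + 2) =
      logK (n + 2) ^ 3 * FLT3 xK yK (xK ^ 2 ^ (n + 2)) (yK ^ 2 ^ (n + 2)) := by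
  have h := ρ.sumLT_three_mul n
  have hF := FLT3_frob n
  have hp := gVal_prev n
  rw [← gVal_mul_logK n, ← gVal_mul_logK (n + 1)] at h
  rw [show n + 1 + 1 = n + 2 from rfl] at h
  apply mul_left_cancel₀ xK_sq_add_ne_zero
  apply mul_right_cancel₀ (ρ.logK_ne_zero (n + 2))
  rw [h]
  linear_combination logK (n + 2) ^ 4 * hp - logK (n + 2) ^ 4 * hF

theorem sumLE_one_two_eq (ρ : HayesModule L) (n : ℕ) : sumLE 1 [2] (n + 2) =
    logK (n + 2) ^ 3 * (gVal (n + 2) ^ 2 +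
      FLT3 xK yK (xK ^ 2 ^ (n + 2)) (yK ^ 2 ^ (n + 2))) := by
  rw [sumLE_eq, ← ρ.logK_eq_sumLT, sumLT_singleton_succ, ρ.sumLT_three_eq, ρ.powerSum_three_eq]
  generalize FLT3 xK yK (xK ^ 2 ^ (n + 2)) (yK ^ 2 ^ (n + 2)) = F
  linear_combination (logK (n + 2) ^ 3 * (1 + gVal (n + 2))) * CharTwo.two_eq_zero (R := K)

end HayesModule

/-! ### The value of `FLE12` -/

theorem F12_twist_ne_zero (n : ℕ) :
    F12 xK yK ((xK ^ 2 ^ (n + 2)) ^ 2) ((yK ^ 2 ^ (n + 2)) ^ 2) ≠ 0 := by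
  rw [← frob_succ, ← frob_succ, F12_frob (n + 1)]
  exact mul_ne_zero (one_add_gVal_ne_zero (n + 1)) (pow_ne_zero 2 (gVal_succ_ne_zero (n + 2)))

theorem Cm_ne_zero (n : ℕ) : Cm xK yK (xK ^ 2 ^ (n + 2)) (yK ^ 2 ^ (n + 2)) ≠ 0 := by
  rw [Cm_succ (n + 1)]
  exact pow_ne_zero 2 (CC_succ_ne_zero n)

theorem FLE12_frob_aux (n : ℕ) :
    (U xK (xK ^ 2 ^ (n + 2)) + CC xK yK (xK ^ 2 ^ (n + 2)) (yK ^ 2 ^ (n + 2)) ^ 2) *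
      (1 + gVal (n + 2)) * gVal (n + 2) ^ 2 * (1 + gVal (n + 3)) =
    (Cm xK yK (xK ^ 2 ^ (n + 2)) (yK ^ 2 ^ (n + 2)) * (1 + gVal (n + 3)) +
      CC xK yK (xK ^ 2 ^ (n + 2)) (yK ^ 2 ^ (n + 2)) ^ 2 * gVal (n + 3) * (1 + gVal (n + 2)) *
        gVal (n + 2) ^ 2) *
      (gVal (n + 2) ^ 2 + FLT3 xK yK (xK ^ 2 ^ (n + 2)) (yK ^ 2 ^ (n + 2))) := by
  refine sumLE12_identity (x := xK) (X := xK ^ 2 ^ (n + 2)) rfl (gVal_quadratic (n + 2))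
    (gVal_succ_mul (n + 2)) (gVal_shift_ne_zero (n + 2)) (U_mul _) xK_sq_add_ne_zero ?_ ?_ ?_
  · have h := gVal_mul (n + 2)
    simp only [CC, By, Bx]
    generalize gVal (n + 2) = g at *
    generalize xK ^ 2 ^ (n + 2) = X at *
    generalize yK ^ 2 ^ (n + 2) = Y at *
    generalize xK = x at *
    generalize yK = y at *
    clear * - h
    grind
  · have h := curve_eq
    simp only [CC, By, Bx, Cm]
    generalize xK ^ 2 ^ (n + 2) = X at *
    generalize yK ^ 2 ^ (n + 2) = Y at *
    generalize xK = x at *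
    generalize yK = y at *
    clear * - h
    grind
  · rw [add_mul, FLT3_frob]
    generalize gVal (n + 2) = g at *
    generalize xK ^ 2 ^ (n + 2) = X at *
    generalize xK = x at *
    clear * -
    grind

theorem FLE12_frob (n : ℕ) :
    1 + (g xK yK ((xK ^ 2 ^ (n + 2)) ^ 2) ((yK ^ 2 ^ (n + 2)) ^ 2) ^ 3 *
      CC xK yK (xK ^ 2 ^ (n + 2)) (yK ^ 2 ^ (n + 2)) ^ 2 *
      F12 xK yK (xK ^ 2 ^ (n + 2)) (yK ^ 2 ^ (n + 2))) /
      (Cm xK yK (xK ^ 2 ^ (n + 2)) (yK ^ 2 ^ (n + 2)) *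
        F12 xK yK ((xK ^ 2 ^ (n + 2)) ^ 2) ((yK ^ 2 ^ (n + 2)) ^ 2)) ≠ 0 ∧
    FLE12 xK yK (xK ^ 2 ^ (n + 2)) (yK ^ 2 ^ (n + 2)) =
      gVal (n + 2) ^ 2 + FLT3 xK yK (xK ^ 2 ^ (n + 2)) (yK ^ 2 ^ (n + 2)) := by
  have haux := FLE12_frob_aux n
  have hU := U_add_CC_sq_ne_zero n
  have hCm := Cm_ne_zero n
  have h1 := one_add_gVal_ne_zero n
  have h1' := one_add_gVal_ne_zero (n + 1)
  have hg := gVal_succ_ne_zero (n + 1)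
  have hg' := gVal_succ_ne_zero (n + 2)
  have e' : F12 xK yK ((xK ^ 2 ^ (n + 2)) ^ 2) ((yK ^ 2 ^ (n + 2)) ^ 2) =
      (1 + gVal (n + 3)) * gVal (n + 3) ^ 2 := by
    rw [← frob_succ, ← frob_succ, F12_frob (n + 1)]
  have eg : g xK yK ((xK ^ 2 ^ (n + 2)) ^ 2) ((yK ^ 2 ^ (n + 2)) ^ 2) = gVal (n + 3) := by
    rw [← frob_succ, ← frob_succ, gVal]
  rw [FLE12, J, e', eg, F12_frob]
  rw [show n + 1 + 1 = n + 2 from rfl] at hg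
  rw [show n + 1 + 2 = n + 3 from rfl] at h1'
  rw [show n + 2 + 1 = n + 3 from rfl] at hg'
  generalize gVal (n + 2) ^ 2 + FLT3 xK yK (xK ^ 2 ^ (n + 2)) (yK ^ 2 ^ (n + 2)) = τ at *
  generalize gVal (n + 3) = g' at *
  generalize gVal (n + 2) = g at *
  generalize CC xK yK (xK ^ 2 ^ (n + 2)) (yK ^ 2 ^ (n + 2)) = c at *
  generalize Cm xK yK (xK ^ 2 ^ (n + 2)) (yK ^ 2 ^ (n + 2)) = m at *
  generalize U xK (xK ^ 2 ^ (n + 2)) = u at *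
  -- The denominator of `J` is a factor of the right side of `haux`, whose left side is nonzero
  -- because `U + C²` is.
  have hden : m * (1 + g') + c ^ 2 * g' * (1 + g) * g ^ 2 ≠ 0 := by
    intro h
    rw [h, zero_mul] at haux
    exact mul_ne_zero (mul_ne_zero (mul_ne_zero hU h1) (pow_ne_zero 2 hg)) h1' haux
  have hJ : 1 + g' ^ 3 * c ^ 2 * ((1 + g) * g ^ 2) / (m * ((1 + g') * g' ^ 2)) =
      (m * (1 + g') + c ^ 2 * g' * (1 + g) * g ^ 2) / (m * (1 + g')) := by
    field_simp
  rw [hJ]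
  refine ⟨div_ne_zero hden (mul_ne_zero hCm h1'), ?_⟩
  rw [div_div_eq_mul_div, div_mul_eq_mul_div, div_div, div_eq_iff (mul_ne_zero hden hCm)]
  linear_combination m * haux

end MZV

end

/-! ### Assembly of the six formulas -/

open MZV in
theorem theorem3p5 {L : Type*} [Field L] [Algebra K L] (ρ : HayesModule L) (d : ℕ) (hd : 2 ≤ d) :
    ρ.logCoeff d ≠ 0 ∧
    SpecializesTo d (F1 xx yy XX YY) (ρ.ell d * algebraMap K L (sumAt 1 [] d)) ∧
    SpecializesTo d (FLT1 xx yy XX YY) (ρ.ell d * algebraMap K L (sumLT [1] d)) ∧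
    SpecializesTo d (F12 xx yy XX YY) (ρ.ell d ^ 3 * algebraMap K L (sumAt 1 [2] d)) ∧
    SpecializesTo d (F3 xx yy XX YY) (ρ.ell d ^ 3 * algebraMap K L (sumAt 3 [] d)) ∧
    SpecializesTo d (FLT3 xx yy XX YY) (ρ.ell d ^ 3 * algebraMap K L (sumLT [3] d)) ∧
    SpecializesTo d (FLE12 xx yy XX YY) (ρ.ell d ^ 3 * algebraMap K L (sumLE 1 [2] d)) := by
  obtain ⟨n, rfl⟩ := Nat.exists_eq_add_of_le' hd
  have hl := ρ.logK_ne_zero (n + 2)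
  have hX := hasSpec_XX (n + 2)
  have hY := hasSpec_YY (n + 2)
  have hC := CC_ne_zero n
  have hD := xK_frob_ne (n + 2)
  have hm := xK_frob_ne' (n + 2)
  have hF1 : F1 xK yK (xK ^ 2 ^ (n + 2)) (yK ^ 2 ^ (n + 2)) ≠ 0 := by
    rw [F1_frob]
    exact one_add_gVal_ne_zero n
  -- The twists in `J` are values on the next graph, so regularity of (vi) also needs the
  -- denominators at `d + 1`.
  have hC2 := CC_ne_zero (n + 1)
  have hD2 := xK_frob_ne (n + 3)
  rw [show n + 1 + 2 = n + 2 + 1 from rfl, frob_succ xK (n + 2), frob_succ yK (n + 2)] at hC2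
  rw [show n + 3 = n + 2 + 1 from rfl, frob_succ xK (n + 2)] at hD2
  obtain ⟨hJ, hE⟩ := FLE12_frob n
  have ell_eq : ρ.ell (n + 2) = algebraMap K L (logK (n + 2))⁻¹ := by
    rw [HayesModule.ell, ρ.logCoeff_eq, map_inv₀]
  refine ⟨?_, (hasSpec_F1 hX hY hC).specializesTo ?_, (hasSpec_FLT1 hX hY hC hD).specializesTo ?_,
    (hasSpec_F12 hX hY hC hD).specializesTo ?_, (hasSpec_F3 hX hY hC hD).specializesTo ?_,
    (hasSpec_FLT3 hX hY hC hD hm hF1).specializesTo ?_,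
    (hasSpec_FLE12 hX hY hC hD hC2 hD2 (Cm_ne_zero n) (F12_twist_ne_zero n) hJ).specializesTo ?_⟩
  · rw [ρ.logCoeff_eq]
    exact (_root_.map_ne_zero _).2 hl
  all_goals
    rw [ell_eq]
    first | rw [← map_pow, ← map_mul] | rw [← map_mul]
    congr 1
  · rw [F1_frob, sumAt, sumLT, mul_one, ρ.powerSum_one_eq]
    field_simp
  · rw [FLT1_frob, ρ.sumLT_one_eq]
    field_simp
  · rw [F12_frob, sumAt, sumLT_two, ρ.sumLT_one_eq, ρ.powerSum_one_eq]
    field_simp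
  · rw [F3_frob, sumAt, sumLT, mul_one, ρ.powerSum_three_eq]
    field_simp
  · rw [ρ.sumLT_three_eq]
    field_simp
  · rw [hE, ρ.sumLE_one_two_eq]
    field_simp
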